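/- An instance of the Minimum Clique Routing Problem on Cycles (MCRPC) with uniform weights consists of a cycle with nodes $1,\dots,n$, a finite family $\mathcal D$ of demands $p=(i,j)$ with $1\le i<j\le n$ (several demands may have the same ends), and weights $\mathbf w_p\in\mathbb N$, $p\in\mathcal D$, that are all equal. Orient the cycle as the circuit $(1,2,\dots,n)$, let $[i,j]$ denote the directed path from $i$ to $j$ in it, and for a demand $p=(i,j)$ put $p^+=[i,j]$, $p^-=[j,i]$ and $e(p)=\{i,j\}$. A routing $R$ chooses a route $R_p\in\{p^+,p^-\}$ for every $p\in\mathcal D$. Let $H_R$ be the graph on $\mathcal D$ in which two different demands $p,q$ are adjacent if $R_p$ and $R_q$ share an arc, and let $\omega(H_R,\mathbf w)$ be the maximum weight of a clique of $H_R$. The problem is to find a routing $R$ that attains $c\ell(\mathcal D,\mathbf w)=\min_R\omega(H_R,\mathbf w)$, and this value. Two demands $p,q$ cross if $e(p)$ has exactly one element on each of the paths $q^+$ and $q^-$, and are parallel otherwise. Let $\mathcal D(p)$ be the family of all demands $q$ parallel to $p$ with $e(q)\ne e(p)$, and let $k=\max_{p\in\mathcal D}|\mathcal D\setminus\mathcal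 D(p)|$. Theorem. There is an algorithm that, for every instance of the MCRPC with uniform weights, computes an optimal routing and the optimal value $c\ell(\mathcal D,\mathbf w)$ and, if $\mathcal D\neq\emptyset$, runs in time $O(2^k|\mathcal D|^4)$ (and in time $O(1)$ if $\mathcal D=\emptyset$). In particular the problem is fixed-parameter tractable with respect to $k$. Here time is the number of steps of a random access machine with unit-cost addition, subtraction, comparison and indirect addressing, on words of $O(\log(n+|\mathcal D|+\max_p\mathbf w_p+2))$ bits. -/

import Mathlib

/-! ### Instances, routes and the intersection graph

The cycle has the nodes `1, …, n` and is oriented as the circuit `(1, 2, …, n)`; its arc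
`(a, a + 1)` (and `(n, 1)` when `a = n`) is named by its tail `a`. -/

namespace MCRPC

/-- The arcs of the directed path `[i, j]` of the circuit `(1, …, n)`, for distinct nodes. -/
def pathArcs (n i j : ℕ) : Finset ℕ :=
  if i < j then Finset.Ico i j else Finset.Icc i n ∪ Finset.Ico 1 j

/-- The vertices of the directed path `[i, j]` of the circuit `(1, …, n)`, for distinct nodes. -/
def pathVerts (n i j : ℕ) : Finset ℕ :=
  if i < j then Finset.Icc i j else Finset.Icc i n ∪ Finset.Icc 1 j

/-- An instance: a cycle on `n` nodes and `m` weighted demands `p = (lo p, hi p)`. Demands are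
indexed by `Fin m`, so that several demands may have the same ends. -/
structure Instance where
  /-- number of nodes of the cycle -/
  n : ℕ
  /-- number of demands -/
  m : ℕ
  /-- smaller end of a demand -/
  lo : Fin m → ℕ
  /-- larger end of a demand -/
  hi : Fin m → ℕ
  /-- weight of a demand -/
  w : Fin m → ℕ
  one_le_lo : ∀ p, 1 ≤ lo p
  lo_lt_hi : ∀ p, lo p < hi p
  hi_le_n : ∀ p, hi p ≤ n

namespace Instance

variable (I : Instance)

/-- All weights are equal. -/
def Uniform : Prop := ∃ c : ℕ, ∀ p, I.w p = c

/-- The ends `e(p)` of a demand. -/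
def ends (p : Fin I.m) : Finset ℕ := {I.lo p, I.hi p}

/-- Arc set of `p⁺ = [lo p, hi p]` (for `true`) and of `p⁻ = [hi p, lo p]` (for `false`). -/
def routeArcs (p : Fin I.m) : Bool → Finset ℕ
  | true => pathArcs I.n (I.lo p) (I.hi p)
  | false => pathArcs I.n (I.hi p) (I.lo p)

/-- Vertex set of `p⁺` (for `true`) and of `p⁻` (for `false`). -/
def routeVerts (p : Fin I.m) : Bool → Finset ℕ
  | true => pathVerts I.n (I.lo p) (I.hi p)
  | false => pathVerts I.n (I.hi p) (I.lo p)

/-- A routing chooses `p⁺` (`true`) or `p⁻` (`false`) for every demand `p`. -/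
abbrev Routing : Type := Fin I.m → Bool

/-- The intersection graph `H` of all routes: different routes `p⁺`, `p⁻` are adjacent when they
share an arc. -/
def H : SimpleGraph (Fin I.m × Bool) where
  Adj x y := x ≠ y ∧ (I.routeArcs x.1 x.2 ∩ I.routeArcs y.1 y.2).Nonempty
  symm := ⟨fun _ _ h => ⟨h.1.symm, by rw [Finset.inter_comm]; exact h.2⟩⟩
  loopless := ⟨fun _ h => h.1 rfl⟩

/-- The subgraph `H_R` of `H` induced by the routes of `R`, with the vertex `(p, R p)` named by the
demand `p`. -/
def HR (R : I.Routing) : SimpleGraph (Fin I.m) := I.H.comap fun p => (p, R p)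

open Classical in
/-- `ω(H_R, w)`, the maximum weight of a clique of `H_R`. -/
noncomputable def omega (R : I.Routing) : ℕ :=
  (Finset.univ.filter fun Q : Finset (Fin I.m) => (I.HR R).IsClique (Q : Set (Fin I.m))).sup
    fun Q => ∑ p ∈ Q, I.w p

/-- The optimal value: the minimum of `ω(H_R, w)` over all routings `R`. -/
noncomputable def cl : ℕ := ⨅ R : I.Routing, I.omega R

/-- Two demands cross when the first has exactly one end on each of the two routes of the second;
otherwise they are parallel. -/
def Cross (p q : Fin I.m) : Prop :=
  (I.ends p ∩ I.routeVerts q true).card = 1 ∧ (I.ends p ∩ I.routeVerts q false).card = 1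

instance (p q : Fin I.m) : Decidable (I.Cross p q) :=
  inferInstanceAs (Decidable (_ ∧ _))

/-- `D(p)`: the demands that are parallel to `p` and have different ends. -/
def parallelTo (p : Fin I.m) : Finset (Fin I.m) :=
  Finset.univ.filter fun q => ¬ I.Cross p q ∧ I.ends q ≠ I.ends p

/-- The parameter `k = max_p |D \ D(p)|` (`0` when there are no demands). -/
def k : ℕ := Finset.univ.sup fun p : Fin I.m => (Finset.univ \ I.parallelTo p).card

/-- The magnitude of the numbers in the input (nodes, number of demands, largest weight). -/
def size : ℕ := I.n + I.m + Finset.univ.sup I.w + 2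

end Instance

/-! ### A random access machine with unit cost

Structured programs over finitely many registers and an indirectly addressed memory. There is
no multiplication, and all numbers that are ever written are required not to exceed a bound `B`
(the word size): a program that writes a larger number gets stuck. -/

/-- Contents of the registers and of the memory. -/
structure State where
  /-- registers -/
  reg : ℕ → ℕ
  /-- memory -/
  mem : ℕ → ℕ

/-- Programs; `x`, `y`, `z` are fixed names of registers. -/
inductive Prog where
  /-- do nothing -/
  | skip : Prog
  /-- `x := v` -/
  | const (x v : ℕ) : Prog
  /-- `x := y` -/
  | copy (x y : ℕ) : Prog
  /-- `x := y + z` -/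
  | add (x y z : ℕ) : Prog
  /-- `x := max (y - z) 0` -/
  | sub (x y z : ℕ) : Prog
  /-- `x := mem[y]` -/
  | load (x y : ℕ) : Prog
  /-- `mem[x] := y` -/
  | store (x y : ℕ) : Prog
  /-- first `P`, then `Q` -/
  | seq (P Q : Prog) : Prog
  /-- if `x < y` then `P` else `Q` -/
  | cond (x y : ℕ) (P Q : Prog) : Prog
  /-- while `x < y` do `P` -/
  | loop (x y : ℕ) (P : Prog) : Prog

/-- Write `v` to the register `x`. -/
def State.setReg (σ : State) (x v : ℕ) : State := ⟨Function.update σ.reg x v, σ.mem⟩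

/-- Write `v` to the memory cell `a`. -/
def State.setMem (σ : State) (a v : ℕ) : State := ⟨σ.reg, Function.update σ.mem a v⟩

/-- `Exec B P σ t τ`: started in `σ`, the program `P` halts in `τ` after `t` steps and never
writes a number larger than `B`. Every elementary instruction and every test is one step. -/
inductive Exec (B : ℕ) : Prog → State → ℕ → State → Prop where
  | skip (σ : State) : Exec B Prog.skip σ 1 σ
  | const (σ : State) (x v : ℕ) (h : v ≤ B) :
      Exec B (Prog.const x v) σ 1 (σ.setReg x v)
  | copy (σ : State) (x y : ℕ) (h : σ.reg y ≤ B) :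
      Exec B (Prog.copy x y) σ 1 (σ.setReg x (σ.reg y))
  | add (σ : State) (x y z : ℕ) (h : σ.reg y + σ.reg z ≤ B) :
      Exec B (Prog.add x y z) σ 1 (σ.setReg x (σ.reg y + σ.reg z))
  | sub (σ : State) (x y z : ℕ) (h : σ.reg y - σ.reg z ≤ B) :
      Exec B (Prog.sub x y z) σ 1 (σ.setReg x (σ.reg y - σ.reg z))
  | load (σ : State) (x y : ℕ) (h : σ.mem (σ.reg y) ≤ B) :
      Exec B (Prog.load x y) σ 1 (σ.setReg x (σ.mem (σ.reg y)))
  | store (σ : State) (x y : ℕ) (h : σ.reg y ≤ B) :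
      Exec B (Prog.store x y) σ 1 (σ.setMem (σ.reg x) (σ.reg y))
  | seq {P Q : Prog} {σ τ ρ : State} {s t : ℕ} (h₁ : Exec B P σ s τ) (h₂ : Exec B Q τ t ρ) :
      Exec B (Prog.seq P Q) σ (s + t) ρ
  | cond_true {x y : ℕ} {P Q : Prog} {σ τ : State} {t : ℕ} (h : σ.reg x < σ.reg y)
      (h₁ : Exec B P σ t τ) : Exec B (Prog.cond x y P Q) σ (t + 1) τ
  | cond_false {x y : ℕ} {P Q : Prog} {σ τ : State} {t : ℕ} (h : ¬ σ.reg x < σ.reg y)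
      (h₁ : Exec B Q σ t τ) : Exec B (Prog.cond x y P Q) σ (t + 1) τ
  | loop_done {x y : ℕ} {P : Prog} {σ : State} (h : ¬ σ.reg x < σ.reg y) :
      Exec B (Prog.loop x y P) σ 1 σ
  | loop_step {x y : ℕ} {P : Prog} {σ τ ρ : State} {s t : ℕ} (h : σ.reg x < σ.reg y)
      (h₁ : Exec B P σ s τ) (h₂ : Exec B (Prog.loop x y P) τ t ρ) :
      Exec B (Prog.loop x y P) σ (s + t + 1) ρ

/-- The initial state for an instance: `n` and `m` in the registers `0` and `1`, the two ends and
the weight of the demand `p` in the memory cells `3p`, `3p + 1`, `3p + 2`, and zeros elsewhere. -/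
def Instance.input (I : Instance) : State where
  reg x := if x = 0 then I.n else if x = 1 then I.m else 0
  mem a :=
    if h : a / 3 < I.m then
      if a % 3 = 0 then I.lo ⟨a / 3, h⟩
      else if a % 3 = 1 then I.hi ⟨a / 3, h⟩
      else I.w ⟨a / 3, h⟩
    else 0

/-- The final state `τ` holds a solution: the memory cells `0, …, m - 1` hold an optimal routing
(`1` for `p⁺` and `0` for `p⁻`), and register `0` holds the optimal value. -/
def Instance.IsSolution (I : Instance) (τ : State) : Prop :=
  ∃ R : I.Routing, (∀ p : Fin I.m, τ.mem p = if R p then 1 else 0) ∧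
    (∀ R' : I.Routing, I.omega R ≤ I.omega R') ∧ I.omega R = I.cl ∧ τ.reg 0 = I.cl

end MCRPC

/-!
# An FPT algorithm for the minimum clique routing problem on cycles with uniform weights

With uniform weights `c`, the maximum weight of a clique of `H_R` is `c` times the clique number of
`H_R`, so the task is to minimize the clique number.

*Structure of optimal routings.* Suppose that two routes of `R` cover the cycle and are not
complementary. Reroute both demands. Each new route is contained in the old route of the *other*
demand, so exchanging the two demands maps cliques to cliques: the clique number does not increase,
and the routes get shorter (`exists_shorter`). Hence in a shortest optimal routing a demand `p` with
a longest route decides the routes of all of `D(p)`: a demand of `D(p)` not routed along its own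
side of `p` would have a longer route than `p`, or would cover the cycle together with `p`
(`exists_optimal_forced`). It suffices to try, for each `p`, the at most `2 ^ k` routings of the
demands outside `D(p)`, that is `m * 2 ^ k` routings in all.

*Clique numbers in cubic time.* In a clique let `a` be a demand with a shortest route. Every route
of the clique meets this route without being properly inside it, hence contains its first or its
last arc. Routes that share one of these arcs form a clique, and a route with the first arc is
disjoint from a route with only the last arc exactly when their ends satisfy two inequalities. So
the largest clique belonging to `a` is a largest stable set of a bipartite dominance graph of points
in the plane (`alpha_le_cliqueCard`, `exists_cliqueCard_le_alpha`). Removing greedily a point of the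
second colour, together with a suitable neighbour if there is one, lowers the stability number by
exactly one (`alpha_eq_of_isolated`, `alpha_eq_of_matched`). This takes `O(m ^ 2)` steps for each
`a`.

*The machine.* The algorithm is written in a small language with named variables and arrays, which
is translated to the given machine. `Tot` expresses total correctness with a time bound for the
translated programs, and records that only variables and arrays assigned to in the text of the
program change. The routings of the free demands are enumerated by a binary counter whose digits are
the routes themselves: the number `2 ^ k` may be too large for a machine word.
-/

open Finset

namespace MCRPC

namespace Instance

variable {I : Instance}

/-! ### Clique numbers and the exchange argument -/

theorem mem_routeArcs {p : Fin I.m} {b : Bool} {z : ℕ} :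
    z ∈ I.routeArcs p b ↔ 1 ≤ z ∧ z ≤ I.n ∧
      (if b then I.lo p ≤ z ∧ z < I.hi p else I.hi p ≤ z ∨ z < I.lo p) := by
  have h1 := I.one_le_lo p
  have h2 := I.lo_lt_hi p
  have h3 := I.hi_le_n p
  cases b
  · simp [routeArcs, pathArcs, not_lt.2 h2.le]
    omega
  · simp [routeArcs, pathArcs, h2]
    omega

theorem mem_routeArcs_not {p : Fin I.m} {b : Bool} {z : ℕ} (h1 : 1 ≤ z) (hn : z ≤ I.n) :
    z ∈ I.routeArcs p (!b) ↔ z ∉ I.routeArcs p b := by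
  cases b <;> simp [mem_routeArcs, h1, hn] <;> omega

theorem HR_adj {R : I.Routing} {p q : Fin I.m} :
    (I.HR R).Adj p q ↔ p ≠ q ∧ ∃ z, z ∈ I.routeArcs p (R p) ∧ z ∈ I.routeArcs q (R q) := by
  have h : (p, R p) ≠ (q, R q) ↔ p ≠ q := by
    constructor
    · rintro h rfl
      exact h rfl
    · intro h h'
      exact h (Prod.ext_iff.1 h').1
  simp only [HR, H, SimpleGraph.comap_adj, h, Finset.Nonempty, mem_inter]

open Classical in
/-- The largest number of demands in a clique of `H_R`. -/
noncomputable def cliqueCard (R : I.Routing) : ℕ :=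
  (univ.filter fun Q : Finset (Fin I.m) => (I.HR R).IsClique (Q : Set (Fin I.m))).sup card

theorem card_le_cliqueCard {R : I.Routing} {Q : Finset (Fin I.m)}
    (hQ : (I.HR R).IsClique (Q : Set (Fin I.m))) : Q.card ≤ cliqueCard R := by
  classical
  exact Finset.le_sup (f := card) (by simpa using hQ)

theorem exists_isClique_card_eq (R : I.Routing) :
    ∃ Q : Finset (Fin I.m), (I.HR R).IsClique (Q : Set (Fin I.m)) ∧ Q.card = cliqueCard R := by
  classical
  obtain ⟨Q, hQ, h⟩ := Finset.exists_mem_eq_sup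
    (univ.filter fun Q : Finset (Fin I.m) => (I.HR R).IsClique (Q : Set (Fin I.m)))
    ⟨∅, by simp⟩ card
  exact ⟨Q, by simpa using hQ, h.symm⟩

theorem cliqueCard_le (R : I.Routing) : cliqueCard R ≤ I.m := by
  obtain ⟨Q, -, h⟩ := exists_isClique_card_eq R
  rw [← h]
  simpa using card_le_univ Q

/-- Equal weights reduce the problem to clique numbers. The exchange argument needs this: it preserves
the number of demands in a clique, but not their individual weights. -/
theorem omega_eq_mul {c : ℕ} (hc : ∀ p, I.w p = c) (R : I.Routing) :
    I.omega R = cliqueCard R * c := by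
  classical
  refine le_antisymm (Finset.sup_le fun Q hQ => ?_) ?_
  · simp only [hc, sum_const, smul_eq_mul]
    exact Nat.mul_le_mul_right c (card_le_cliqueCard (by simpa using hQ))
  · obtain ⟨Q, hQ, h⟩ := exists_isClique_card_eq R
    have := Finset.le_sup (f := fun Q : Finset (Fin I.m) => ∑ p ∈ Q, I.w p)
      (s := univ.filter fun Q : Finset (Fin I.m) => (I.HR R).IsClique (Q : Set (Fin I.m)))
      (b := Q) (by simpa using hQ)
    simpa [omega, hc, h] using this

theorem cl_eq_omega {R : I.Routing} (hR : ∀ R', I.omega R ≤ I.omega R') : I.cl = I.omega R :=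
  le_antisymm (ciInf_le (OrderBot.bddBelow _) R) (le_ciInf hR)

/-- If a permutation of the demands sends every route of `R'` to a route of `R` that contains it,
then it maps the cliques of `H_R'` to cliques of `H_R`. -/
theorem cliqueCard_le_of_perm {R R' : I.Routing} (e : Equiv.Perm (Fin I.m))
    (h : ∀ x, I.routeArcs x (R' x) ⊆ I.routeArcs (e x) (R (e x))) :
    cliqueCard R' ≤ cliqueCard R := by
  obtain ⟨Q, hQ, hc⟩ := exists_isClique_card_eq R'
  rw [← hc, ← card_map e.toEmbedding]
  refine card_le_cliqueCard fun x hx y hy hxy => ?_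
  simp only [coe_map, Equiv.coe_toEmbedding, Set.mem_image, mem_coe] at hx hy
  obtain ⟨x, hx, rfl⟩ := hx
  obtain ⟨y, hy, rfl⟩ := hy
  obtain ⟨-, z, hz, hz'⟩ := HR_adj.1 (hQ hx hy fun h => hxy (h ▸ rfl))
  exact HR_adj.2 ⟨hxy, z, h x hz, h y hz'⟩

/-- The sum of the lengths of all routes. -/
def totalLength (R : I.Routing) : ℕ := ∑ x, (I.routeArcs x (R x)).card

/-- Exchange step: if two routes of `R` cover the cycle and are not complementary, rerouting both
demands shortens the routing and does not increase the clique number. The transposition of the two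
demands serves as the permutation in `cliqueCard_le_of_perm`. -/
theorem exists_shorter {R : I.Routing} {p q : Fin I.m}
    (h : I.routeArcs p (!R p) ⊂ I.routeArcs q (R q)) :
    ∃ R' : I.Routing, cliqueCard R' ≤ cliqueCard R ∧ totalLength R' < totalLength R := by
  have hpq : p ≠ q := by
    rintro rfl
    obtain ⟨z, hz, -⟩ := Finset.exists_of_ssubset h
    obtain ⟨h1, hn, -⟩ := mem_routeArcs.1 hz
    have hlo := I.one_le_lo p
    have hlt := I.lo_lt_hi p
    have hhi := I.hi_le_n p
    have hne : I.lo p ∈ I.routeArcs p (!R p) ∨ I.hi p ∈ I.routeArcs p (!R p) := by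
      cases R p <;> simp [mem_routeArcs] <;> omega
    rcases hne with h' | h'
    · exact (mem_routeArcs_not (by omega) (by omega)).1 h' (h.1 h')
    · exact (mem_routeArcs_not (by omega) (by omega)).1 h' (h.1 h')
  let R' : I.Routing := fun x => if x = p ∨ x = q then !R x else R x
  have hsub : ∀ x, I.routeArcs x (R' x) ⊆
      I.routeArcs (Equiv.swap p q x) (R (Equiv.swap p q x)) := by
    intro x
    by_cases hxp : x = p
    · subst hxp
      simpa [R'] using h.1
    · by_cases hxq : x = q
      · subst hxq
        simp only [R', or_true, if_true, Equiv.swap_apply_right]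
        intro z hz
        obtain ⟨h1, hn, -⟩ := mem_routeArcs.1 hz
        by_contra hzp
        exact (mem_routeArcs_not h1 hn).1 hz (h.1 ((mem_routeArcs_not h1 hn).2 hzp))
      · simp [R', hxp, hxq, Equiv.swap_apply_of_ne_of_ne hxp hxq]
  refine ⟨R', cliqueCard_le_of_perm _ hsub, ?_⟩
  rw [totalLength, totalLength,
    ← Equiv.sum_comp (Equiv.swap p q) fun x => (I.routeArcs x (R x)).card]
  refine sum_lt_sum (fun x _ => card_le_card (hsub x)) ⟨p, mem_univ _, card_lt_card ?_⟩
  simpa [R'] using h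

theorem cross_iff {p q : Fin I.m} : I.Cross p q ↔
    (I.lo p < I.lo q ∧ I.lo q < I.hi p ∧ I.hi p < I.hi q) ∨
      (I.lo q < I.lo p ∧ I.lo p < I.hi q ∧ I.hi q < I.hi p) := by
  have hp1 := I.one_le_lo p
  have hp2 := I.lo_lt_hi p
  have hp3 := I.hi_le_n p
  have hq1 := I.one_le_lo q
  have hq2 := I.lo_lt_hi q
  have hq3 := I.hi_le_n q
  have key : ∀ s : Finset ℕ, (I.ends p ∩ s).card =
      (if I.lo p ∈ s then 1 else 0) + (if I.hi p ∈ s then 1 else 0) := by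
    intro s
    rw [ends, ← filter_mem_eq_inter, card_filter, sum_pair hp2.ne]
  simp only [Cross, key, routeVerts, pathVerts, hq2, not_lt.2 hq2.le, if_true, if_false, mem_Icc,
    mem_union]
  split_ifs <;> omega

theorem ends_eq_iff {p q : Fin I.m} : I.ends q = I.ends p ↔ I.lo q = I.lo p ∧ I.hi q = I.hi p := by
  have hp2 := I.lo_lt_hi p
  have hq2 := I.lo_lt_hi q
  constructor
  · intro h
    have h1 : I.lo q ∈ I.ends p := h ▸ by simp [ends]
    have h2 : I.hi q ∈ I.ends p := h ▸ by simp [ends]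
    simp only [ends, mem_insert, mem_singleton] at h1 h2
    omega
  · rintro ⟨h1, h2⟩
    simp [ends, h1, h2]

theorem mem_parallelTo {p q : Fin I.m} : q ∈ I.parallelTo p ↔
    ¬ ((I.lo p < I.lo q ∧ I.lo q < I.hi p ∧ I.hi p < I.hi q) ∨
      (I.lo q < I.lo p ∧ I.lo p < I.hi q ∧ I.hi q < I.hi p)) ∧
    ¬ (I.lo q = I.lo p ∧ I.hi q = I.hi p) := by
  simp [parallelTo, cross_iff, ends_eq_iff]

/-- The route of a demand `q` parallel to `p` that stays on one side of `p`. -/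
def forced (p q : Fin I.m) : Bool := !decide (I.lo q ≤ I.lo p ∧ I.hi p ≤ I.hi q)

/-- The other route of `q` contains one of the two routes of `p`. -/
theorem ssubset_of_ne_forced {p q : Fin I.m} (hq : q ∈ I.parallelTo p) {b c : Bool}
    (hc : c ≠ forced p q) :
    I.routeArcs p b ⊂ I.routeArcs q c ∨ I.routeArcs p (!b) ⊂ I.routeArcs q c := by
  have hp1 := I.one_le_lo p
  have hp2 := I.lo_lt_hi p
  have hp3 := I.hi_le_n p
  have hq1 := I.one_le_lo q
  have hq2 := I.lo_lt_hi q
  have hq3 := I.hi_le_n q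
  rw [mem_parallelTo] at hq
  suffices h : I.routeArcs p true ⊂ I.routeArcs q c ∨ I.routeArcs p false ⊂ I.routeArcs q c by
    cases b
    · exact h.symm
    · exact h
  by_cases hf : I.lo q ≤ I.lo p ∧ I.hi p ≤ I.hi q
  · have hc' : c = true := by simpa [forced, hf] using hc
    subst hc'
    left
    refine (Finset.ssubset_iff_of_subset fun z hz => ?_).2 ?_
    · simp only [mem_routeArcs, if_true] at hz ⊢
      omega
    · by_cases h : I.lo q = I.lo p
      · refine ⟨I.hi p, ?_, ?_⟩ <;> simp only [mem_routeArcs, if_true] <;> omega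
      · refine ⟨I.lo q, ?_, ?_⟩ <;> simp only [mem_routeArcs, if_true] <;> omega
  · have hc' : c = false := by
      simp only [forced, hf, decide_false, Bool.not_false] at hc
      simpa using hc
    subst hc'
    by_cases hin : I.lo p ≤ I.lo q ∧ I.hi q ≤ I.hi p
    · right
      refine (Finset.ssubset_iff_of_subset fun z hz => ?_).2 ?_
      · simp only [mem_routeArcs, Bool.false_eq_true, if_false] at hz ⊢
        omega
      · by_cases h : I.lo q = I.lo p
        · refine ⟨I.hi q, ?_, ?_⟩ <;>
            simp only [mem_routeArcs, Bool.false_eq_true, if_false] <;> omega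
        · refine ⟨I.lo p, ?_, ?_⟩ <;>
            simp only [mem_routeArcs, Bool.false_eq_true, if_false] <;> omega
    · left
      refine (Finset.ssubset_iff_of_subset fun z hz => ?_).2 ⟨I.n, ?_, ?_⟩ <;>
        simp only [mem_routeArcs, Bool.false_eq_true, if_false, if_true] at * <;> omega

/-- Some optimal routing sends, for a suitable demand `p`, every demand of `D(p)` along the side of
`p` on which it lies: take a shortest optimal routing and a demand `p` with a longest route. -/
theorem exists_optimal_forced (hm : 0 < I.m) : ∃ (R : I.Routing) (p : Fin I.m),
    (∀ R' : I.Routing, cliqueCard R ≤ cliqueCard R') ∧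
      ∀ q ∈ I.parallelTo p, R q = forced p q := by
  classical
  obtain ⟨R₀, -, hR₀⟩ := exists_min_image (univ : Finset I.Routing) cliqueCard
    ⟨fun _ => true, by simp⟩
  obtain ⟨R, hR, hmin⟩ := exists_min_image
    (univ.filter fun R : I.Routing => cliqueCard R ≤ cliqueCard R₀) totalLength ⟨R₀, by simp⟩
  simp only [mem_filter, mem_univ, true_and] at hR hmin
  have hopt : ∀ R' : I.Routing, cliqueCard R ≤ cliqueCard R' :=
    fun R' => hR.trans (hR₀ R' (mem_univ _))
  obtain ⟨p, -, hp⟩ := exists_max_image univ (fun x => (I.routeArcs x (R x)).card)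
    ⟨⟨0, hm⟩, by simp⟩
  refine ⟨R, p, hopt, fun q hq => ?_⟩
  by_contra hne
  rcases ssubset_of_ne_forced hq hne (b := R p) with h | h
  · exact absurd (card_lt_card h) (not_lt.2 (hp q (mem_univ _)))
  · obtain ⟨R', h1, h2⟩ := exists_shorter h
    exact absurd h2 (not_lt.2 (hmin R' (h1.trans hR)))

end Instance

/-! ### Stable sets of a dominance graph -/

/-- Points `(X q, Y q)` coloured by `c` (colours `1` and `2`; any other colour means absent): the
set `S` of coloured points is stable if no point `l` of colour `1` and `r` of colour `2` in it
satisfy `X l ≤ X r` and `Y r ≤ Y l`. -/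
def Stable (c X Y : ℕ → ℕ) (S : Finset ℕ) : Prop :=
  (∀ q ∈ S, c q = 1 ∨ c q = 2) ∧
    ∀ l ∈ S, ∀ r ∈ S, c l = 1 → c r = 2 → X l ≤ X r → Y l < Y r

open Classical in
/-- The largest size of a stable set among the points `0, …, m - 1`. -/
noncomputable def alpha (m : ℕ) (c X Y : ℕ → ℕ) : ℕ :=
  ((range m).powerset.filter (Stable c X Y)).sup card

variable {m : ℕ} {c X Y : ℕ → ℕ}

theorem Stable.card_le_alpha {S : Finset ℕ} (h : Stable c X Y S) (hS : S ⊆ range m) :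
    S.card ≤ alpha m c X Y := by
  classical
  exact Finset.le_sup (f := card) (by simp [h, hS])

theorem exists_stable_card_eq (m : ℕ) (c X Y : ℕ → ℕ) :
    ∃ S ⊆ range m, Stable c X Y S ∧ S.card = alpha m c X Y := by
  classical
  obtain ⟨S, hS, h⟩ := Finset.exists_mem_eq_sup ((range m).powerset.filter (Stable c X Y))
    ⟨∅, by simp [Stable]⟩ card
  simp only [mem_filter, mem_powerset] at hS
  exact ⟨S, hS.1, hS.2, h.symm⟩

theorem Stable.of_update {S : Finset ℕ} {r : ℕ} (h : Stable (Function.update c r 0) X Y S) :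
    Stable c X Y S ∧ r ∉ S := by
  have hr : r ∉ S := fun hr => by simpa using h.1 r hr
  have hne : ∀ q ∈ S, Function.update c r 0 q = c q := fun q hq =>
    Function.update_of_ne (ne_of_mem_of_not_mem hq hr) _ _
  refine ⟨⟨fun q hq => hne q hq ▸ h.1 q hq, fun l hl r' hr' h1 h2 => ?_⟩, hr⟩
  exact h.2 l hl r' hr' ((hne l hl).trans h1) ((hne r' hr').trans h2)

theorem Stable.erase_update {S : Finset ℕ} (h : Stable c X Y S) (r : ℕ) :
    Stable (Function.update c r 0) X Y (S.erase r) := by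
  have hne : ∀ q ∈ S.erase r, Function.update c r 0 q = c q := fun q hq =>
    Function.update_of_ne (ne_of_mem_erase hq) _ _
  refine ⟨fun q hq => by rw [hne q hq]; exact h.1 q (mem_of_mem_erase hq),
    fun l hl r' hr' h1 h2 => ?_⟩
  exact h.2 l (mem_of_mem_erase hl) r' (mem_of_mem_erase hr') (hne l hl ▸ h1) (hne r' hr' ▸ h2)

/-- A point of colour `2` without a conflict belongs to some largest stable set. -/
theorem alpha_eq_of_isolated {r : ℕ} (hr : r < m) (hcr : c r = 2)
    (hiso : ∀ l < m, c l = 1 → X l ≤ X r → Y l < Y r) :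
    alpha m c X Y = alpha m (Function.update c r 0) X Y + 1 := by
  apply le_antisymm
  · obtain ⟨S, hS, hst, hcard⟩ := exists_stable_card_eq m c X Y
    have := (hst.erase_update r).card_le_alpha ((erase_subset _ _).trans hS)
    have := pred_card_le_card_erase (s := S) (a := r)
    omega
  · obtain ⟨S, hS, hst, hcard⟩ := exists_stable_card_eq m (Function.update c r 0) X Y
    obtain ⟨hst, hrS⟩ := hst.of_update
    rw [← hcard, ← card_insert_of_notMem hrS]
    refine Stable.card_le_alpha ⟨?_, ?_⟩ (insert_subset (by simpa using hr) hS)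
    · intro q hq
      rcases mem_insert.1 hq with rfl | hq
      · exact Or.inr hcr
      · exact hst.1 q hq
    · intro l hl r' hr' h1 h2 hX
      replace hl := mem_of_mem_insert_of_ne hl (by rintro rfl; omega)
      rcases mem_insert.1 hr' with rfl | hr'
      · exact hiso l (by simpa using hS hl) h1 hX
      · exact hst.2 l hl r' hr' h1 h2 hX

/-- Let `r` have the least `X` among the points of colour `2`, and let `l` have the least `Y` among
the points of colour `1` in conflict with `r`. Then some largest stable set contains exactly one of
`l` and `r`: one that contains another point `l'` in conflict with `r` can be enlarged by `l`,
because every remaining point in conflict with `l` is in conflict with `l'`. -/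
theorem alpha_eq_of_matched {l r : ℕ} (hl : l < m) (hr : r < m) (hcl : c l = 1) (hcr : c r = 2)
    (hX : X l ≤ X r) (hY : Y r ≤ Y l) (hrmin : ∀ r' < m, c r' = 2 → X r ≤ X r')
    (hlmin : ∀ l' < m, c l' = 1 → X l' ≤ X r → Y r ≤ Y l' → Y l ≤ Y l') :
    alpha m c X Y = alpha m (Function.update (Function.update c r 0) l 0) X Y + 1 := by
  apply le_antisymm
  · obtain ⟨S, hS, hst, hcard⟩ := exists_stable_card_eq m c X Y
    have h1 := ((hst.erase_update r).erase_update l).card_le_alpha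
      ((erase_subset _ _).trans ((erase_subset _ _).trans hS))
    by_cases hrS : r ∈ S
    · have hlS : l ∉ S.erase r := fun h =>
        absurd (hst.2 l (mem_of_mem_erase h) r hrS hcl hcr hX) (not_lt.2 hY)
      rw [erase_eq_of_notMem hlS] at h1
      have := pred_card_le_card_erase (s := S) (a := r)
      omega
    · rw [erase_eq_of_notMem hrS] at h1
      have := pred_card_le_card_erase (s := S) (a := l)
      omega
  · obtain ⟨S, hS, hst₂, hcard⟩ :=
      exists_stable_card_eq m (Function.update (Function.update c r 0) l 0) X Y
    obtain ⟨hst₁, hlS⟩ := hst₂.of_update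
    obtain ⟨hst, hrS⟩ := hst₁.of_update
    by_cases hex : ∃ l' ∈ S, c l' = 1 ∧ X l' ≤ X r ∧ Y r ≤ Y l'
    · obtain ⟨l', hl'S, hcl', hXl', hYl'⟩ := hex
      have hle := hlmin l' (by simpa using hS hl'S) hcl' hXl' hYl'
      rw [← hcard, ← card_insert_of_notMem hlS]
      refine Stable.card_le_alpha ⟨?_, ?_⟩ (insert_subset (by simpa using hl) hS)
      · intro q hq
        rcases mem_insert.1 hq with rfl | hq
        · exact Or.inl hcl
        · exact hst.1 q hq
      · intro a ha b hb h1 h2 hab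
        replace hb := mem_of_mem_insert_of_ne hb (by rintro rfl; omega)
        rcases mem_insert.1 ha with rfl | ha
        · have := hrmin b (by simpa using hS hb) h2
          have := hst.2 l' hl'S b hb hcl' h2 (by omega)
          omega
        · exact hst.2 a ha b hb h1 h2 hab
    · push Not at hex
      rw [← hcard, ← card_insert_of_notMem hrS]
      refine Stable.card_le_alpha ⟨?_, ?_⟩ (insert_subset (by simpa using hr) hS)
      · intro q hq
        rcases mem_insert.1 hq with rfl | hq
        · exact Or.inr hcr
        · exact hst.1 q hq
      · intro a ha b hb h1 h2 hab
        replace ha := mem_of_mem_insert_of_ne ha (by rintro rfl; omega)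
        rcases mem_insert.1 hb with rfl | hb
        · exact hex a ha h1 hab
        · exact hst.2 a ha b hb h1 h2 hab

theorem alpha_eq_card (h : ∀ q < m, c q ≠ 2) :
    alpha m c X Y = ((range m).filter fun q => c q = 1).card := by
  apply le_antisymm
  · obtain ⟨S, hS, hst, hcard⟩ := exists_stable_card_eq m c X Y
    rw [← hcard]
    refine card_le_card fun q hq => ?_
    have hqm := hS hq
    have := h q (by simpa using hqm)
    have := hst.1 q hq
    simp only [mem_filter]
    exact ⟨hqm, by omega⟩
  · refine Stable.card_le_alpha ⟨fun q hq => Or.inl (mem_filter.1 hq).2, ?_⟩ (filter_subset _ _)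
    intro l _ r hr _ h2
    have := (mem_filter.1 hr).2
    omega

/-! ### Cliques of circular arcs -/

/-- The position in `{1, …, n}` of the node `x` on a cycle with `n` nodes, counted from the
successor of the node `s`; the node `s` itself has position `n`. -/
def pos (n s x : ℕ) : ℕ := if s < x then x - s else x + n - s

theorem pos_bounds {n s x : ℕ} (hs : s ≤ n) (hx : 1 ≤ x) (hxn : x ≤ n) :
    1 ≤ pos n s x ∧ pos n s x ≤ n := by
  unfold pos
  split_ifs <;> omega

theorem exists_pos_eq {n s k : ℕ} (hs : s ≤ n) (hk1 : 1 ≤ k) (hk : k ≤ n) :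
    ∃ z, 1 ≤ z ∧ z ≤ n ∧ pos n s z = k := by
  by_cases h : s + k ≤ n
  · exact ⟨s + k, by omega, h, by unfold pos; split_ifs <;> omega⟩
  · exact ⟨s + k - n, by omega, by omega, by unfold pos; split_ifs <;> omega⟩

namespace Instance

variable {I : Instance}

/-- The first node of the route of `q`. -/
def src (R : I.Routing) (q : Fin I.m) : ℕ := if R q then I.lo q else I.hi q

/-- The last node of the route of `q`. -/
def dst (R : I.Routing) (q : Fin I.m) : ℕ := if R q then I.hi q else I.lo q

theorem src_dst_bounds (R : I.Routing) (q : Fin I.m) :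
    1 ≤ src R q ∧ src R q ≤ I.n ∧ 1 ≤ dst R q ∧ dst R q ≤ I.n ∧ src R q ≠ dst R q := by
  have h1 := I.one_le_lo q
  have h2 := I.lo_lt_hi q
  have h3 := I.hi_le_n q
  unfold src dst
  split_ifs <;> omega

/-- Routes in the coordinates `pos`, for any origin `s`. -/
theorem mem_routeArcs_pos (R : I.Routing) (q : Fin I.m) {s z : ℕ} (hs : s ≤ I.n)
    (hz1 : 1 ≤ z) (hz : z ≤ I.n) : z ∈ I.routeArcs q (R q) ↔
      (pos I.n s (src R q) < pos I.n s (dst R q) →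
        pos I.n s (src R q) ≤ pos I.n s z ∧ pos I.n s z < pos I.n s (dst R q)) ∧
      (pos I.n s (dst R q) < pos I.n s (src R q) →
        pos I.n s (src R q) ≤ pos I.n s z ∨ pos I.n s z < pos I.n s (dst R q)) := by
  have h1 := I.one_le_lo q
  have h2 := I.lo_lt_hi q
  have h3 := I.hi_le_n q
  rw [mem_routeArcs]
  unfold src dst pos
  cases R q <;> simp only [Bool.false_eq_true, if_false, if_true] <;> split_ifs <;> omega

/-- The arrays `c`, `X`, `Y` describe the routes of `R` relative to the route of `a`, with positions
counted from the first node of that route. Colour `1` is given to the routes that contain its first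
arc, colour `2` to the other routes that contain its last arc. -/
structure Describes (R : I.Routing) (a : Fin I.m) (c X Y : ℕ → ℕ) : Prop where
  color : ∀ q : Fin I.m, c q =
    if pos I.n (src R a) (dst R q) < pos I.n (src R a) (src R q) then 1
    else if pos I.n (src R a) (src R q) < pos I.n (src R a) (dst R a) then
      if pos I.n (src R a) (dst R q) < pos I.n (src R a) (dst R a) then 0 else 2
    else 0
  fst : ∀ q : Fin I.m, X q =
    min (pos I.n (src R a) (src R q)) (pos I.n (src R a) (dst R q))
  snd : ∀ q : Fin I.m, Y q =
    max (pos I.n (src R a) (src R q)) (pos I.n (src R a) (dst R q))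

theorem pos_src_ne_pos_dst (R : I.Routing) (q : Fin I.m) {s : ℕ} (hs : s ≤ I.n) :
    pos I.n s (src R q) ≠ pos I.n s (dst R q) := by
  have := src_dst_bounds R q
  unfold pos
  split_ifs <;> omega

theorem Describes.color_eq_one {R : I.Routing} {a : Fin I.m} {c X Y : ℕ → ℕ}
    (h : Describes R a c X Y) (q : Fin I.m) :
    c q = 1 ↔ pos I.n (src R a) (dst R q) < pos I.n (src R a) (src R q) := by
  rw [h.color]
  split_ifs <;> simp_all

theorem Describes.color_eq_two {R : I.Routing} {a : Fin I.m} {c X Y : ℕ → ℕ}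
    (h : Describes R a c X Y) (q : Fin I.m) :
    c q = 2 ↔ pos I.n (src R a) (src R q) < pos I.n (src R a) (dst R q) ∧
      pos I.n (src R a) (src R q) < pos I.n (src R a) (dst R a) ∧
      pos I.n (src R a) (dst R a) ≤ pos I.n (src R a) (dst R q) := by
  have := pos_src_ne_pos_dst R q (src_dst_bounds R a).2.1
  rw [h.color]
  split_ifs <;> simp <;> omega

/-- Routes of the same colour share the first or the last arc of the route of `a`; routes of
different colours are disjoint exactly when they are in conflict. -/
theorem alpha_le_cliqueCard {R : I.Routing} {a : Fin I.m} {c X Y : ℕ → ℕ}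
    (h : Describes R a c X Y) : alpha I.m c X Y ≤ cliqueCard R := by
  obtain ⟨S, hS, hst, hcard⟩ := exists_stable_card_eq I.m c X Y
  obtain ⟨ha1, han, -⟩ := src_dst_bounds R a
  have hmap : (univ.filter fun q : Fin I.m => (q : ℕ) ∈ S).map Fin.valEmbedding = S := by
    ext x
    simp only [mem_map, mem_filter, mem_univ, true_and, Fin.valEmbedding_apply]
    constructor
    · rintro ⟨q, hq, rfl⟩
      exact hq
    · intro hx
      exact ⟨⟨x, by simpa using hS hx⟩, hx, rfl⟩
  rw [← hcard, ← hmap, card_map]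
  -- a common arc, given by its position
  have common : ∀ p q : Fin I.m, (p : ℕ) ∈ S → (q : ℕ) ∈ S → c p ≤ c q →
      ∃ z, z ∈ I.routeArcs p (R p) ∧ z ∈ I.routeArcs q (R q) := by
    intro p q hp hq hpq
    have hp' := hst.1 p hp
    have hq' := hst.1 q hq
    have hpq' := hst.2 p hp q hq
    have bp := src_dst_bounds R p
    have bq := src_dst_bounds R q
    have ba := src_dst_bounds R a
    have np := pos_src_ne_pos_dst R p han
    have nq := pos_src_ne_pos_dst R q han
    have p1 := pos_bounds han bp.1 bp.2.1
    have p2 := pos_bounds han bp.2.2.1 bp.2.2.2.1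
    have q1 := pos_bounds han bq.1 bq.2.1
    have q2 := pos_bounds han bq.2.2.1 bq.2.2.2.1
    have a2 := pos_bounds han ba.2.2.1 ba.2.2.2.1
    have key : ∃ k, 1 ≤ k ∧ k ≤ I.n ∧ ∀ x ∈ [p, q],
        (pos I.n (src R a) (src R x) < pos I.n (src R a) (dst R x) →
          pos I.n (src R a) (src R x) ≤ k ∧ k < pos I.n (src R a) (dst R x)) ∧
        (pos I.n (src R a) (dst R x) < pos I.n (src R a) (src R x) →
          pos I.n (src R a) (src R x) ≤ k ∨ k < pos I.n (src R a) (dst R x)) := by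
      rw [h.fst, h.fst, h.snd, h.snd, h.color_eq_one, h.color_eq_two] at hpq'
      have hne : pos I.n (src R a) (dst R p) < pos I.n (src R a) (src R p) ∨
          ¬ pos I.n (src R a) (dst R q) < pos I.n (src R a) (src R q) := by
        rw [← h.color_eq_one, ← h.color_eq_one]
        omega
      rw [h.color_eq_one, h.color_eq_two] at hp' hq'
      simp only [List.mem_cons, List.not_mem_nil, or_false, forall_eq_or_imp, forall_eq]
      revert p1 p2 q1 q2 a2 np nq hp' hq' hne hpq'
      generalize pos I.n (src R a) (src R p) = sp
      generalize pos I.n (src R a) (dst R p) = tp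
      generalize pos I.n (src R a) (src R q) = sq
      generalize pos I.n (src R a) (dst R q) = tq
      generalize pos I.n (src R a) (dst R a) = L
      intros
      rcases lt_or_ge tq sq with h1 | h1
      · exact ⟨I.n, by omega, le_rfl, by omega⟩
      · rcases lt_or_ge tp sp with h2 | h2
        · rcases lt_or_ge sq tp with h3 | h3
          · exact ⟨sq, by omega, by omega, by omega⟩
          · exact ⟨tq - 1, by omega, by omega, by omega⟩
        · exact ⟨L - 1, by omega, by omega, by omega⟩
    obtain ⟨k, hk1, hkn, hk⟩ := key
    obtain ⟨z, hz1, hzn, rfl⟩ := exists_pos_eq han hk1 hkn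
    exact ⟨z, (mem_routeArcs_pos R p han hz1 hzn).2 (hk p (by simp)),
      (mem_routeArcs_pos R q han hz1 hzn).2 (hk q (by simp))⟩
  refine card_le_cliqueCard fun p hp q hq hpq => HR_adj.2 ⟨hpq, ?_⟩
  simp only [coe_filter, mem_univ, true_and, Set.mem_ofPred_eq] at hp hq
  rcases le_total (c p) (c q) with hc | hc
  · exact common p q hp hq hc
  · obtain ⟨z, h1, h2⟩ := common q p hq hp hc
    exact ⟨z, h2, h1⟩

/-- A route of a largest clique with the fewest arcs contains no other route of the clique, so that
every route of the clique contains its first or its last arc. -/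
theorem exists_cliqueCard_le_alpha (R : I.Routing) (hm : 0 < I.m) :
    ∃ a : Fin I.m, ∀ c X Y, Describes R a c X Y → cliqueCard R ≤ alpha I.m c X Y := by
  obtain ⟨Q, hQ, hcard⟩ := exists_isClique_card_eq R
  have hne : Q.Nonempty := by
    rw [← card_pos, hcard]
    have := card_le_cliqueCard (R := R) (Q := {⟨0, hm⟩}) (by simp)
    simpa [Nat.succ_le_iff] using this
  obtain ⟨a, haQ, hmin⟩ := exists_min_image Q (fun x => (I.routeArcs x (R x)).card) hne
  refine ⟨a, fun c X Y h => ?_⟩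
  obtain ⟨ha1, han, -⟩ := src_dst_bounds R a
  have hcolor : ∀ q ∈ Q, c q = 1 ∨ c q = 2 := by
    intro q hq
    by_contra hcon
    have bq := src_dst_bounds R q
    have ba := src_dst_bounds R a
    have nq := pos_src_ne_pos_dst R q han
    have q2 := pos_bounds han bq.2.2.1 bq.2.2.2.1
    have hself : pos I.n (src R a) (src R a) = I.n := by simp [pos]
    have na := pos_src_ne_pos_dst R a han
    have a2 := pos_bounds han ba.2.2.1 ba.2.2.2.1
    rw [h.color_eq_one, h.color_eq_two] at hcon
    have hqa : q ≠ a := by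
      rintro rfl
      omega
    by_cases hL : pos I.n (src R a) (src R q) < pos I.n (src R a) (dst R a)
    · -- the route of `q` is properly contained in the route of `a`
      refine absurd (card_lt_card ?_) (not_lt.2 (hmin q hq))
      refine (Finset.ssubset_iff_of_subset fun z hz => ?_).2 ⟨src R a, ?_, ?_⟩
      · obtain ⟨hz1, hzn, -⟩ := mem_routeArcs.1 hz
        rw [mem_routeArcs_pos R _ han hz1 hzn] at hz ⊢
        omega
      · rw [mem_routeArcs_pos R _ han ha1 han]
        omega
      · rw [mem_routeArcs_pos R _ han ha1 han]
        omega
    · obtain ⟨-, z, hz, hz'⟩ := HR_adj.1 (hQ hq haQ hqa)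
      obtain ⟨hz1, hzn, -⟩ := mem_routeArcs.1 hz
      rw [mem_routeArcs_pos R _ han hz1 hzn] at hz hz'
      omega
  rw [← hcard, ← card_map Fin.valEmbedding]
  refine Stable.card_le_alpha ⟨?_, ?_⟩ ?_
  · simpa using hcolor
  · simp only [mem_map, Fin.valEmbedding_apply, forall_exists_index, and_imp,
      forall_apply_eq_imp_iff₂]
    intro l hl r hr hcl hcr hX
    have hlr : l ≠ r := by
      rintro rfl
      omega
    obtain ⟨-, z, hz, hz'⟩ := HR_adj.1 (hQ hl hr hlr)
    obtain ⟨hz1, hzn, -⟩ := mem_routeArcs.1 hz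
    rw [mem_routeArcs_pos R _ han hz1 hzn] at hz hz'
    have nl := pos_src_ne_pos_dst R l han
    have nr := pos_src_ne_pos_dst R r han
    rw [h.fst, h.fst] at hX
    rw [h.snd, h.snd]
    rw [h.color_eq_one] at hcl
    rw [h.color_eq_two] at hcr
    omega
  · intro x hx
    simp only [mem_map, Fin.valEmbedding_apply] at hx
    obtain ⟨q, -, rfl⟩ := hx
    simp

end Instance

/-! ### Programs with named variables and arrays -/

/-- The variables of the algorithm; each is held in the register given by its index. -/
inductive Var where
  | res | demands | nodes | one | zero | weight | idP | idQ | idU | idA | loP | hiP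
  | valX | valY | valZ | flag | bit | bound | done | bestVal | cliqueVal | count
  | origin | len | minX | minY | big | right | left
  deriving DecidableEq

/-- The arrays of the algorithm, each with one cell for every demand. -/
inductive Arr where
  | out | loEnd | hiEnd | route | free | bestRoute | first | last | color | ptX | ptY
  deriving DecidableEq

/-- The block of `m` memory cells that holds an array. The first three blocks hold the input; the
array `out` reuses the first one, where the output is expected. -/
def Arr.code : Arr → ℕ
  | .out => 0
  | .loEnd => 3
  | .hiEnd => 4
  | .route => 5
  | .free => 6
  | .bestRoute => 7
  | .first => 8
  | .last => 9
  | .color => 10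
  | .ptX => 11
  | .ptY => 12

theorem Arr.code_injective : Function.Injective Arr.code := by
  intro j k h
  cases j <;> cases k <;> first | rfl | exact absurd h (by decide)

theorem Arr.code_lt (j : Arr) : j.code < 13 := by
  cases j <;> decide

theorem Var.ctorIdx_injective : Function.Injective Var.ctorIdx := by
  intro x y h
  rw [← Var.ofNat_ctorIdx x, ← Var.ofNat_ctorIdx y, h]

theorem Var.ctorIdx_lt (x : Var) : x.ctorIdx < 39 := by
  cases x <;> decide

/-- Programs over named variables and arrays; `load x j y` is `x := j[y]` and `store j x y` is
`j[x] := y`. -/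
inductive HProg where
  | skip : HProg
  | const (x : Var) (v : ℕ) : HProg
  | copy (x y : Var) : HProg
  | add (x y z : Var) : HProg
  | sub (x y z : Var) : HProg
  | load (x : Var) (j : Arr) (y : Var) : HProg
  | store (j : Arr) (x y : Var) : HProg
  | seq (P Q : HProg) : HProg
  | cond (x y : Var) (P Q : HProg) : HProg
  | loop (x y : Var) (P : HProg) : HProg

namespace HProg

/-- Translation into programs of the machine. Register `40 + j.code` holds the address of the array
`j`, and register `39` is a scratch register for addresses. -/
def compile : HProg → Prog
  | skip => .skip
  | const x v => .const x.ctorIdx v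
  | copy x y => .copy x.ctorIdx y.ctorIdx
  | add x y z => .add x.ctorIdx y.ctorIdx z.ctorIdx
  | sub x y z => .sub x.ctorIdx y.ctorIdx z.ctorIdx
  | load x j y => .seq (.add 39 (40 + j.code) y.ctorIdx) (.load x.ctorIdx 39)
  | store j x y => .seq (.add 39 (40 + j.code) x.ctorIdx) (.store 39 y.ctorIdx)
  | seq P Q => .seq P.compile Q.compile
  | cond x y P Q => .cond x.ctorIdx y.ctorIdx P.compile Q.compile
  | loop x y P => .loop x.ctorIdx y.ctorIdx P.compile

/-- Whether a program contains an assignment to the variable `v`. -/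
def writesVar (v : Var) : HProg → Bool
  | skip => false
  | const x _ => x = v
  | copy x _ => x = v
  | add x _ _ => x = v
  | sub x _ _ => x = v
  | load x _ _ => x = v
  | store _ _ _ => false
  | seq P Q => P.writesVar v || Q.writesVar v
  | cond _ _ P Q => P.writesVar v || Q.writesVar v
  | loop _ _ P => P.writesVar v

/-- Whether a program contains an assignment to a cell of the array `k`. -/
def writesArr (k : Arr) : HProg → Bool
  | store j _ _ => j = k
  | seq P Q => P.writesArr k || Q.writesArr k
  | cond _ _ P Q => P.writesArr k || Q.writesArr k
  | loop _ _ P => P.writesArr k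
  | _ => false

/-- `for i = 0, …, m - 1 do P`, with the bound and the increment taken from the variables
`demands` and `one`. -/
def forLoop (i : Var) (P : HProg) : HProg :=
  seq (const i 0) (loop i .demands (seq P (add i i .one)))

end HProg

/-- Contents of the variables and arrays. -/
structure HState where
  /-- variables -/
  v : Var → ℕ
  /-- arrays -/
  a : Arr → ℕ → ℕ

namespace HState

/-- Write `r` to the variable `x`. -/
def setV (s : HState) (x : Var) (r : ℕ) : HState := ⟨Function.update s.v x r, s.a⟩

/-- Write `r` to the cell `i` of the array `j`. -/
def setA (s : HState) (j : Arr) (i r : ℕ) : HState :=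
  ⟨s.v, Function.update s.a j (Function.update (s.a j) i r)⟩

variable (s : HState)

@[simp] theorem setV_v (x y : Var) (r : ℕ) : (s.setV x r).v y = if y = x then r else s.v y := by
  simp [setV, Function.update_apply]

@[simp] theorem setV_a (x : Var) (r : ℕ) : (s.setV x r).a = s.a := rfl

@[simp] theorem setA_v (j : Arr) (i r : ℕ) : (s.setA j i r).v = s.v := rfl

@[simp] theorem setA_a (j k : Arr) (i r : ℕ) :
    (s.setA j i r).a k = if k = j then Function.update (s.a j) i r else s.a k := by
  simp [setA, Function.update_apply]

end HState

/-- The machine state `σ` represents `s` for arrays of length `m`, and holds no number above `B`. -/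
structure Rep (B m : ℕ) (s : HState) (σ : State) : Prop where
  var : ∀ x : Var, σ.reg x.ctorIdx = s.v x
  base : ∀ j : Arr, σ.reg (40 + j.code) = j.code * m
  arr : ∀ (j : Arr) (i : ℕ), i < m → σ.mem (j.code * m + i) = s.a j i
  reg_le : ∀ x, σ.reg x ≤ B
  mem_le : ∀ i, σ.mem i ≤ B

/-- `s'` differs from `s` at most in variables and arrays to which `P` assigns. -/
def Frame (P : HProg) (s s' : HState) : Prop :=
  (∀ x, P.writesVar x = false → s'.v x = s.v x) ∧ ∀ j, P.writesArr j = false → s'.a j = s.a j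

theorem Frame.refl (P : HProg) (s : HState) : Frame P s s := ⟨fun _ _ => rfl, fun _ _ => rfl⟩

theorem Frame.trans {P : HProg} {s s' s'' : HState} (h : Frame P s s') (h' : Frame P s' s'') :
    Frame P s s'' :=
  ⟨fun x hx => (h'.1 x hx).trans (h.1 x hx), fun j hj => (h'.2 j hj).trans (h.2 j hj)⟩

/-- Total correctness: from every machine state that represents `s`, the translation of `P` halts,
after `t` steps and in a state that represents some `s'` with `Q t s'`. -/
def Tot (B m : ℕ) (P : HProg) (Q : ℕ → HState → Prop) (s : HState) : Prop :=
  ∀ σ, Rep B m s σ → ∃ t τ s', Exec B P.compile σ t τ ∧ Rep B m s' τ ∧ Frame P s s' ∧ Q t s'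

section Rules

variable {B m : ℕ} {P P' : HProg} {Q Q' : ℕ → HState → Prop} {s : HState}

theorem Rep.setV {σ : State} (h : Rep B m s σ) (x : Var) {r : ℕ} (hr : r ≤ B) :
    Rep B m (s.setV x r) (σ.setReg x.ctorIdx r) where
  var y := by
    simp [State.setReg, Function.update_apply, Var.ctorIdx_injective.eq_iff, h.var]
  base j := by
    have := x.ctorIdx_lt
    simp only [State.setReg]
    rw [Function.update_of_ne (by omega), h.base]
  arr := h.arr
  reg_le y := by
    simp only [State.setReg, Function.update_apply]
    split_ifs
    · exact hr
    · exact h.reg_le y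
  mem_le := h.mem_le

theorem Rep.setScratch {σ : State} (h : Rep B m s σ) {r : ℕ} (hr : r ≤ B) :
    Rep B m s (σ.setReg 39 r) where
  var y := by
    have := y.ctorIdx_lt
    simp only [State.setReg]
    rw [Function.update_of_ne (by omega), h.var]
  base j := by
    simp only [State.setReg]
    rw [Function.update_of_ne (by omega), h.base]
  arr := h.arr
  reg_le y := by
    simp only [State.setReg, Function.update_apply]
    split_ifs
    · exact hr
    · exact h.reg_le y
  mem_le := h.mem_le

theorem Arr.address_inj {j k : Arr} {i l : ℕ} (hi : i < m) (hl : l < m)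
    (h : j.code * m + i = k.code * m + l) : j = k ∧ i = l := by
  have hm : 0 < m := by omega
  have h1 : (j.code * m + i) / m = (k.code * m + l) / m := by rw [h]
  have h2 : (j.code * m + i) % m = (k.code * m + l) % m := by rw [h]
  rw [mul_comm, mul_comm k.code, Nat.mul_add_div hm, Nat.mul_add_div hm, Nat.div_eq_of_lt hi,
    Nat.div_eq_of_lt hl] at h1
  rw [mul_comm, mul_comm k.code, Nat.mul_add_mod, Nat.mul_add_mod, Nat.mod_eq_of_lt hi,
    Nat.mod_eq_of_lt hl] at h2
  exact ⟨Arr.code_injective h1, h2⟩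

theorem Arr.address_le (hB : 13 * m ≤ B) (j : Arr) {i : ℕ} (hi : i < m) : j.code * m + i ≤ B := by
  have := j.code_lt
  have : (j.code + 1) * m ≤ 13 * m := Nat.mul_le_mul_right m (by omega)
  rw [add_mul] at this
  omega

theorem Rep.setA {σ : State} (h : Rep B m s σ) (j : Arr) {i r : ℕ} (hi : i < m) (hr : r ≤ B) :
    Rep B m (s.setA j i r) (σ.setMem (j.code * m + i) r) where
  var := h.var
  base := h.base
  arr k l hl := by
    simp only [State.setMem, HState.setA_a]
    by_cases hkl : k = j ∧ l = i
    · obtain ⟨rfl, rfl⟩ := hkl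
      simp
    · rw [Function.update_of_ne fun e => hkl (Arr.address_inj hl hi e), h.arr k l hl]
      split_ifs with hk
      · subst hk
        rw [Function.update_of_ne fun e => hkl ⟨rfl, e⟩]
      · rfl
  reg_le := h.reg_le
  mem_le y := by
    simp only [State.setMem, Function.update_apply]
    split_ifs
    · exact hr
    · exact h.mem_le y

theorem Tot.mono (h : Tot B m P Q s) (hQ : ∀ t s', Frame P s s' → Q t s' → Q' t s') :
    Tot B m P Q' s := by
  intro σ hσ
  obtain ⟨t, τ, s', h1, h2, h3, h4⟩ := h σ hσ
  exact ⟨t, τ, s', h1, h2, h3, hQ t s' h3 h4⟩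

theorem Tot.skip (h : Q 1 s) : Tot B m .skip Q s := fun σ hσ =>
  ⟨1, σ, s, .skip σ, hσ, .refl _ _, h⟩

theorem frame_setV {x : Var} {r : ℕ} (hx : P.writesVar x = true) : Frame P s (s.setV x r) := by
  refine ⟨fun y hy => ?_, fun _ _ => rfl⟩
  have : y ≠ x := by
    rintro rfl
    simp [hx] at hy
  simp [this]

theorem Tot.const {x : Var} {r : ℕ} (hr : r ≤ B) (h : Q 1 (s.setV x r)) :
    Tot B m (.const x r) Q s := fun σ hσ =>
  ⟨1, _, _, .const σ x.ctorIdx r hr, hσ.setV x hr, frame_setV (by simp [HProg.writesVar]), h⟩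

theorem Tot.copy {x y : Var} (h : Q 1 (s.setV x (s.v y))) : Tot B m (.copy x y) Q s := by
  intro σ hσ
  have e := hσ.var y
  have hle := hσ.reg_le y.ctorIdx
  refine ⟨1, _, _, .copy σ x.ctorIdx y.ctorIdx hle, ?_, frame_setV (by simp [HProg.writesVar]), h⟩
  rw [← e]
  exact hσ.setV x hle

theorem Tot.add {x y z : Var} (hle : s.v y + s.v z ≤ B) (h : Q 1 (s.setV x (s.v y + s.v z))) :
    Tot B m (.add x y z) Q s := by
  intro σ hσ
  rw [← hσ.var y, ← hσ.var z] at hle h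
  exact ⟨1, _, _, .add σ x.ctorIdx y.ctorIdx z.ctorIdx hle, hσ.setV x hle,
    frame_setV (by simp [HProg.writesVar]), h⟩

theorem Tot.sub {x y z : Var} (h : Q 1 (s.setV x (s.v y - s.v z))) :
    Tot B m (.sub x y z) Q s := by
  intro σ hσ
  have hle := (Nat.sub_le _ (σ.reg z.ctorIdx)).trans (hσ.reg_le y.ctorIdx)
  rw [← hσ.var y, ← hσ.var z] at h
  exact ⟨1, _, _, .sub σ x.ctorIdx y.ctorIdx z.ctorIdx hle, hσ.setV x hle,
    frame_setV (by simp [HProg.writesVar]), h⟩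

theorem Tot.load {x y : Var} {j : Arr} (hB : 13 * m ≤ B) (hy : s.v y < m)
    (h : Q 2 (s.setV x (s.a j (s.v y)))) : Tot B m (.load x j y) Q s := by
  intro σ hσ
  have e : σ.reg (40 + j.code) + σ.reg y.ctorIdx = j.code * m + s.v y := by
    rw [hσ.base, hσ.var]
  have hle := Arr.address_le hB j hy
  have e' := hσ.arr j _ hy
  have hle' : s.a j (s.v y) ≤ B := e' ▸ hσ.mem_le _
  refine ⟨1 + 1, _, _, .seq (.add σ 39 (40 + j.code) y.ctorIdx (e ▸ hle))
    (.load _ x.ctorIdx 39 ?_), ?_, frame_setV (by simp [HProg.writesVar]), h⟩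
  · simpa [State.setReg, e, e'] using hle'
  · have := (hσ.setScratch (r := j.code * m + s.v y) hle).setV x hle'
    simpa [State.setReg, e, e'] using this

theorem Tot.store {x y : Var} {j : Arr} (hB : 13 * m ≤ B) (hx : s.v x < m)
    (h : Q 2 (s.setA j (s.v x) (s.v y))) : Tot B m (.store j x y) Q s := by
  intro σ hσ
  have e : σ.reg (40 + j.code) + σ.reg x.ctorIdx = j.code * m + s.v x := by
    rw [hσ.base, hσ.var]
  have hle := Arr.address_le hB j hx
  have hy39 : y.ctorIdx ≠ 39 := y.ctorIdx_lt.ne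
  have hle' : s.v y ≤ B := hσ.var y ▸ hσ.reg_le _
  refine ⟨1 + 1, _, s.setA j (s.v x) (s.v y), .seq (.add σ 39 (40 + j.code) x.ctorIdx (e ▸ hle))
    (.store _ 39 y.ctorIdx ?_), ?_, ⟨fun _ _ => rfl, fun k hk => ?_⟩, h⟩
  · simpa [State.setReg, hy39, hσ.var] using hle'
  · have := (hσ.setScratch (r := j.code * m + s.v x) hle).setA j hx hle'
    simpa [State.setReg, hσ.base, hy39, hσ.var] using this
  · have : k ≠ j := by
      rintro rfl
      simp [HProg.writesArr] at hk
    simp [this]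

theorem Tot.seq (h : Tot B m P (fun t s' => Tot B m P' (fun t' s'' => Q (t + t') s'') s') s) :
    Tot B m (.seq P P') Q s := by
  intro σ hσ
  obtain ⟨t, τ, s', h1, h2, h3, h4⟩ := h σ hσ
  obtain ⟨t', ρ, s'', k1, k2, k3, k4⟩ := h4 τ h2
  refine ⟨t + t', ρ, s'', .seq h1 k1, k2, ⟨fun x hx => ?_, fun j hj => ?_⟩, k4⟩
  · simp only [HProg.writesVar, Bool.or_eq_false_iff] at hx
    rw [k3.1 x hx.2, h3.1 x hx.1]
  · simp only [HProg.writesArr, Bool.or_eq_false_iff] at hj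
    rw [k3.2 j hj.2, h3.2 j hj.1]

theorem Tot.cond {x y : Var} (h1 : s.v x < s.v y → Tot B m P (fun t => Q (t + 1)) s)
    (h2 : ¬ s.v x < s.v y → Tot B m P' (fun t => Q (t + 1)) s) :
    Tot B m (.cond x y P P') Q s := by
  intro σ hσ
  by_cases hxy : s.v x < s.v y
  · obtain ⟨t, τ, s', k1, k2, k3, k4⟩ := h1 hxy σ hσ
    rw [← hσ.var, ← hσ.var] at hxy
    refine ⟨t + 1, τ, s', .cond_true hxy k1, k2, ⟨fun x hx => ?_, fun j hj => ?_⟩, k4⟩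
    · simp only [HProg.writesVar, Bool.or_eq_false_iff] at hx
      exact k3.1 x hx.1
    · simp only [HProg.writesArr, Bool.or_eq_false_iff] at hj
      exact k3.2 j hj.1
  · obtain ⟨t, τ, s', k1, k2, k3, k4⟩ := h2 hxy σ hσ
    rw [← hσ.var, ← hσ.var] at hxy
    refine ⟨t + 1, τ, s', .cond_false hxy k1, k2, ⟨fun x hx => ?_, fun j hj => ?_⟩, k4⟩
    · simp only [HProg.writesVar, Bool.or_eq_false_iff] at hx
      exact k3.1 x hx.2
    · simp only [HProg.writesArr, Bool.or_eq_false_iff] at hj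
      exact k3.2 j hj.2

/-- Rule for loops whose number of remaining iterations is bounded by a variant `V`, with `T` steps
for each pass. -/
theorem Tot.loop {x y : Var} {Inv : HState → Prop} {V : HState → ℕ} {T : ℕ} (h0 : Inv s)
    (hstep : ∀ s', Inv s' → Frame P s s' → s'.v x < s'.v y →
      Tot B m P (fun t s'' => t ≤ T ∧ Inv s'' ∧ V s'' < V s') s')
    (hQ : ∀ t s', t ≤ V s * (T + 1) + 1 → Frame P s s' → Inv s' → ¬ s'.v x < s'.v y → Q t s') :
    Tot B m (.loop x y P) Q s := by
  have main : ∀ N s', V s' ≤ N → Inv s' → Frame P s s' → Tot B m (.loop x y P)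
      (fun t s'' => t ≤ V s' * (T + 1) + 1 ∧ Inv s'' ∧ ¬ s''.v x < s''.v y) s' := by
    intro N
    induction N with
    | zero =>
      intro s' hV hI hF σ hσ
      by_cases hxy : s'.v x < s'.v y
      · obtain ⟨t, τ, s'', -, -, -, -, -, h⟩ := hstep s' hI hF hxy σ hσ
        omega
      · have hxy' := hxy
        rw [← hσ.var, ← hσ.var] at hxy'
        exact ⟨1, σ, s', .loop_done hxy', hσ, .refl _ _, by omega, hI, hxy⟩
    | succ N ih =>
      intro s' hV hI hF σ hσ
      by_cases hxy : s'.v x < s'.v y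
      · obtain ⟨t, τ, s'', h1, h2, h3, h4, h5, h6⟩ := hstep s' hI hF hxy σ hσ
        obtain ⟨t', ρ, s₃, k1, k2, k3, k4, k5⟩ := ih s'' (by omega) h5 (hF.trans h3) τ h2
        have hxy' := hxy
        rw [← hσ.var, ← hσ.var] at hxy'
        refine ⟨t + t' + 1, ρ, s₃, .loop_step hxy' h1 k1, k2, ⟨fun x hx => ?_, fun j hj => ?_⟩,
          ?_, k5⟩
        · exact (k3.1 x hx).trans (h3.1 x hx)
        · exact (k3.2 j hj).trans (h3.2 j hj)
        · have : (V s'' + 1) * (T + 1) ≤ V s' * (T + 1) := Nat.mul_le_mul_right _ h6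
          rw [add_mul] at this
          omega
      · have hxy' := hxy
        rw [← hσ.var, ← hσ.var] at hxy'
        exact ⟨1, σ, s', .loop_done hxy', hσ, .refl _ _, by omega, hI, hxy⟩
  refine (main _ s le_rfl h0 (.refl _ _)).mono fun t s' hF h => hQ t s' h.1 hF h.2.1 h.2.2

/-- Rule for counting loops, with `T` steps for each pass; `Inv r` is to hold after `r` passes. -/
theorem Tot.forLoop {i : Var} (Inv : ℕ → HState → Prop) (T : ℕ) (hi : P.writesVar i = false)
    (him : i ≠ .demands) (hi1 : i ≠ .one) (hPm : P.writesVar .demands = false)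
    (hP1 : P.writesVar .one = false) (hB : m ≤ B) (hm : s.v .demands = m) (h1 : s.v .one = 1)
    (h0 : Inv 0 (s.setV i 0))
    (hstep : ∀ r s', r < m → Frame (HProg.forLoop i P) s s' → s'.v i = r → Inv r s' →
      Tot B m P (fun t s'' => t ≤ T ∧ Inv (r + 1) (s''.setV i (r + 1))) s')
    (hQ : ∀ t s', t ≤ m * (T + 2) + 2 → Frame (HProg.forLoop i P) s s' → s'.v i = m →
      Inv m s' → Q t s') :
    Tot B m (HProg.forLoop i P) Q s := by
  have hwm : (HProg.forLoop i P).writesVar .demands = false := by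
    simp [HProg.forLoop, HProg.writesVar, him, hPm]
  have hw1 : (HProg.forLoop i P).writesVar .one = false := by
    simp [HProg.forLoop, HProg.writesVar, hi1, hP1]
  refine Tot.mono (Q := fun t s' => t ≤ m * (T + 2) + 2 ∧ s'.v i = m ∧ Inv m s') ?_
    fun t s' hF h => hQ t s' h.1 hF h.2.1 h.2.2
  refine Tot.seq (Tot.const (Nat.zero_le _) ?_)
  refine Tot.loop (Inv := fun s' => s'.v i ≤ m ∧ Inv (s'.v i) s') (V := fun s' => m - s'.v i)
    (T := T + 1) (by simpa using h0) ?_ ?_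
  · rintro s' ⟨hle, hI⟩ hF hlt
    have hF' : Frame (HProg.forLoop i P) s s' := by
      refine ⟨fun x hx => ?_, fun j hj => ?_⟩
      · simp only [HProg.forLoop, HProg.writesVar, Bool.or_eq_false_iff] at hx
        have hxi : x ≠ i := by
          rintro rfl
          simp at hx
        rw [hF.1 x (by simpa [HProg.writesVar] using hx.2)]
        simp [hxi]
      · simp only [HProg.forLoop, HProg.writesArr, Bool.false_or] at hj
        rw [hF.2 j (by simpa [HProg.writesArr] using hj)]
        simp
    rw [hF'.1 .demands hwm, hm] at hlt
    refine Tot.seq ((hstep _ s' hlt hF' rfl hI).mono fun t s'' hF'' h => ?_)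
    have e1 : s''.v .one = 1 := by rw [hF''.1 _ hP1, hF'.1 _ hw1, h1]
    have e2 : s''.v i = s'.v i := hF''.1 _ hi
    refine Tot.add (by omega) ?_
    simp only [e1, e2, HState.setV_v, if_true]
    exact ⟨by omega, ⟨by omega, h.2⟩, by omega⟩
  · rintro t s' ht hF ⟨hle, hI⟩ hge
    have em : s'.v .demands = m := by
      rw [hF.1 .demands (by simp [HProg.writesVar, hPm, him])]
      simp [hm, him.symm]
    have e : s'.v i = m := by omega
    simp only [HState.setV_v, if_true, Nat.sub_zero] at ht
    rw [e] at hI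
    exact ⟨by rw [show T + 2 = T + 1 + 1 from rfl]; omega, e, hI⟩

end Rules

/-! ### Weakest preconditions -/

/-- Weakest precondition of `Q`, computed for programs without loops. -/
def HProg.wp (B m : ℕ) : HProg → (ℕ → HState → Prop) → HState → Prop
  | skip, Q, s => Q 1 s
  | const x r, Q, s => r ≤ B ∧ Q 1 (s.setV x r)
  | copy x y, Q, s => Q 1 (s.setV x (s.v y))
  | add x y z, Q, s => s.v y + s.v z ≤ B ∧ Q 1 (s.setV x (s.v y + s.v z))
  | sub x y z, Q, s => Q 1 (s.setV x (s.v y - s.v z))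
  | load x j y, Q, s => s.v y < m ∧ Q 2 (s.setV x (s.a j (s.v y)))
  | store j x y, Q, s => s.v x < m ∧ Q 2 (s.setA j (s.v x) (s.v y))
  | seq P P', Q, s => P.wp B m (fun t s' => P'.wp B m (fun t' s'' => Q (t + t') s'') s') s
  | cond x y P P', Q, s => (s.v x < s.v y → P.wp B m (fun t => Q (t + 1)) s) ∧
      (¬ s.v x < s.v y → P'.wp B m (fun t => Q (t + 1)) s)
  | loop x y P, Q, s => Tot B m (loop x y P) Q s

section Basics

variable {B m : ℕ} {Q : ℕ → HState → Prop} {s : HState}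

theorem Tot.of_wp (hB : 13 * m ≤ B) {P : HProg} (h : P.wp B m Q s) : Tot B m P Q s := by
  induction P generalizing Q s with
  | skip => exact .skip h
  | const x r => exact .const h.1 h.2
  | copy x y => exact .copy h
  | add x y z => exact .add h.1 h.2
  | sub x y z => exact .sub h
  | load x j y => exact .load hB h.1 h.2
  | store j x y => exact .store hB h.1 h.2
  | seq P P' ih ih' => exact .seq ((ih h).mono fun t s' _ h' => ih' h')
  | cond x y P P' ih ih' => exact .cond (fun c => ih (h.1 c)) fun c => ih' (h.2 c)
  | loop x y P => exact h

theorem forall_lt_add_one {Φ : ℕ → Prop} {r : ℕ} (h : ∀ q < r, Φ q) (hr : Φ r) :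
    ∀ q < r + 1, Φ q := by
  intro q hq
  rcases Nat.lt_succ_iff_lt_or_eq.1 hq with hq | rfl
  · exact h q hq
  · exact hr

end Basics

/-- No assignment of the program changes the input, the constants or the variable `big`. -/
def HProg.keepsInput (P : HProg) : Bool :=
  !P.writesVar .demands && !P.writesVar .nodes && !P.writesVar .one && !P.writesVar .zero &&
    !P.writesVar .big && !P.writesArr .loEnd && !P.writesArr .hiEnd

/-- The state holds the instance `I` and the constants used by the algorithm. -/
structure Holds (I : Instance) (s : HState) : Prop where
  demands : s.v .demands = I.m
  nodes : s.v .nodes = I.n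
  one : s.v .one = 1
  zero : s.v .zero = 0
  big : s.v .big = I.n + 1
  lo : ∀ q : Fin I.m, s.a .loEnd q = I.lo q
  hi : ∀ q : Fin I.m, s.a .hiEnd q = I.hi q

theorem Holds.frame {I : Instance} {s s' : HState} (h : Holds I s) {P : HProg} (hF : Frame P s s')
    (hP : P.keepsInput = true) : Holds I s' := by
  simp only [HProg.keepsInput, Bool.and_eq_true, Bool.not_eq_true'] at hP
  obtain ⟨⟨⟨⟨⟨⟨h1, h2⟩, h3⟩, h4⟩, h5⟩, h6⟩, h7⟩ := hP
  exact ⟨(hF.1 _ h1).trans h.demands, (hF.1 _ h2).trans h.nodes, (hF.1 _ h3).trans h.one,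
    (hF.1 _ h4).trans h.zero, (hF.1 _ h5).trans h.big,
    fun q => (congrFun (hF.2 _ h6) q).trans (h.lo q),
    fun q => (congrFun (hF.2 _ h7) q).trans (h.hi q)⟩

namespace HProg

/-! ### The routings to be tried for one demand -/

/-- Mark a demand as free and give it the bit `0`. -/
def markFree : HProg := seq (const .flag 1) (const .bit 0)

/-- Decide whether the demand with ends `valX`, `valY` is free or forced by the demand with ends
`loP`, `hiP`; `bit` receives its route. -/
def decideFree : HProg :=
  seq (const .flag 0) <| seq (const .bit 1) <|
    cond .loP .valX
      (cond .valX .hiP (cond .hiP .valY markFree skip) skip)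
      (cond .valY .hiP (cond .valX .loP (cond .loP .valY markFree skip) skip)
        (cond .valX .loP (const .bit 0) (cond .hiP .valY (const .bit 0) markFree)))

/-- For the demand `idP`, route the demands parallel to it as forced, and mark the others as free. -/
def setup : HProg :=
  seq (load .loP .loEnd .idP) <| seq (load .hiP .hiEnd .idP) <|
    forLoop .idQ <| seq (load .valX .loEnd .idQ) <| seq (load .valY .hiEnd .idQ) <|
      seq decideFree <| seq (store .free .idQ .flag) (store .route .idQ .bit)

/-- Increment the binary number formed by the routes of the free demands; `done` receives the
carry. -/
def advance : HProg :=
  seq (const .done 1) <| forLoop .idQ <| seq (load .valX .free .idQ) <|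
    cond .zero .valX
      (cond .zero .done
        (seq (load .valY .route .idQ) <|
          cond .zero .valY (store .route .idQ .zero)
            (seq (store .route .idQ .one) (const .done 0))) skip) skip

end HProg

section Specs

variable {I : Instance} {B : ℕ} {s : HState}

open Instance

theorem decideFree_spec (hB : 13 * I.m ≤ B) (hB1 : 1 ≤ B) {p q : Fin I.m} (h1 : s.v .loP = I.lo p)
    (h2 : s.v .hiP = I.hi p) (h3 : s.v .valX = I.lo q) (h4 : s.v .valY = I.hi q) :
    Tot B I.m .decideFree (fun t s' => t ≤ 8 ∧
      s'.v .flag = (if q ∈ I.parallelTo p then 0 else 1) ∧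
      s'.v .bit = (if q ∈ I.parallelTo p then (if forced p q then 1 else 0) else 0)) s := by
  have hp := I.lo_lt_hi p
  have hq := I.lo_lt_hi q
  refine Tot.of_wp hB ?_
  simp only [HProg.decideFree, HProg.markFree, HProg.wp, HState.setV_v, reduceCtorEq, if_false,
    if_true, h1, h2, h3, h4, mem_parallelTo, forced, Bool.not_eq_true', decide_eq_false_iff_not]
  refine ⟨by omega, by omega, ?_⟩
  split_ifs <;> omega

theorem setup_spec (hI : Holds I s) (hB : 13 * I.m ≤ B) (hB1 : 1 ≤ B) {p : Fin I.m}
    (hp : s.v .idP = p) :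
    Tot B I.m .setup (fun t s' => t ≤ 18 * I.m + 6 ∧ ∀ q : Fin I.m,
      s'.a .free q = (if q ∈ I.parallelTo p then 0 else 1) ∧
      s'.a .route q = (if q ∈ I.parallelTo p then (if forced p q then 1 else 0) else 0)) s := by
  refine .seq <| .load hB (by simp [hp]) <| .seq <| .load hB (by simp [hp]) ?_
  refine .forLoop (fun r s' => ∀ q : Fin I.m, (q : ℕ) < r →
      s'.a .free q = (if q ∈ I.parallelTo p then 0 else 1) ∧
      s'.a .route q = (if q ∈ I.parallelTo p then (if forced p q then 1 else 0) else 0)) 16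
    rfl (by decide) (by decide) rfl rfl (by omega) (by simp [hI.demands]) (by simp [hI.one])
    (by simp) ?_ ?_
  · intro r s' hr hF hi hInv
    have hlo : s'.v .loP = I.lo p := by
      rw [hF.1 _ rfl]; simp [hp, hI.lo]
    have hhi : s'.v .hiP = I.hi p := by
      rw [hF.1 _ rfl]; simp [hp, hI.hi]
    have hq1 : s'.a .loEnd r = I.lo ⟨r, hr⟩ := by
      rw [hF.2 _ rfl]; simpa using hI.lo ⟨r, hr⟩
    have hq2 : s'.a .hiEnd r = I.hi ⟨r, hr⟩ := by
      rw [hF.2 _ rfl]; simpa using hI.hi ⟨r, hr⟩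
    refine .seq <| .load hB (by omega) <| .seq <| .load hB (by simpa [hi] using hr) <| .seq ?_
    refine (decideFree_spec hB hB1 (p := p) (q := ⟨r, hr⟩) (by simpa using hlo) (by simpa using hhi)
      (by simpa [hi] using hq1) (by simpa [hi] using hq2)).mono fun t s'' hF' h => ?_
    have hi' : s''.v .idQ = r := by rw [hF'.1 _ rfl]; simpa using hi
    have hfr : s''.a .free = s'.a .free := by rw [hF'.2 _ rfl]; simp
    have hrt : s''.a .route = s'.a .route := by rw [hF'.2 _ rfl]; simp
    refine Tot.of_wp hB ?_
    simp only [HProg.wp, HState.setA_v, HState.setA_a, HState.setV_a, reduceCtorEq, if_false,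
      if_true, hi', hfr, hrt]
    refine ⟨hr, hr, by omega, fun q hq => ?_⟩
    by_cases hqr : (q : ℕ) = r
    · obtain rfl : q = ⟨r, hr⟩ := Fin.ext hqr
      simpa using h.2
    · simpa [Function.update_of_ne hqr] using hInv q (by omega)
  · intro t s' ht hF hi hInv
    exact ⟨by omega, fun q => hInv q q.2⟩

/-- The number of free demands with index below `u`. -/
def rank (fr : ℕ → ℕ) (u : ℕ) : ℕ := ∑ q ∈ range u, fr q

/-- The binary number formed by the routes of the free demands with index below `u`. -/
def binVal (fr rt : ℕ → ℕ) (u : ℕ) : ℕ := ∑ q ∈ range u, fr q * (rt q * 2 ^ rank fr q)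

theorem binVal_congr {fr rt rt' : ℕ → ℕ} {u : ℕ} (h : ∀ q < u, rt q = rt' q) :
    binVal fr rt u = binVal fr rt' u :=
  sum_congr rfl fun q hq => by rw [h q (by simpa using hq)]

theorem binVal_lt {fr rt : ℕ → ℕ} {u : ℕ} (hfr : ∀ q < u, fr q ≤ 1) (hrt : ∀ q < u, rt q ≤ 1) :
    binVal fr rt u < 2 ^ rank fr u := by
  induction u with
  | zero => simp [binVal, rank]
  | succ u ih =>
    have h := ih (fun q hq => hfr q (by omega)) fun q hq => hrt q (by omega)
    have h1 := hfr u (by omega)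
    have h2 := hrt u (by omega)
    rw [binVal, rank, sum_range_succ, sum_range_succ, ← binVal, ← rank]
    interval_cases fr u
    · simpa using h
    · have : rt u * 2 ^ rank fr u ≤ 1 * 2 ^ rank fr u := Nat.mul_le_mul_right _ h2
      rw [pow_succ]
      omega

theorem binVal_inj {fr rt rt' : ℕ → ℕ} {u : ℕ} (hfr : ∀ q < u, fr q ≤ 1) (hrt : ∀ q < u, rt q ≤ 1)
    (hrt' : ∀ q < u, rt' q ≤ 1) (h : binVal fr rt u = binVal fr rt' u) :
    ∀ q < u, fr q = 1 → rt q = rt' q := by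
  induction u with
  | zero => simp
  | succ u ih =>
    have l := binVal_lt (u := u) (fun q hq => hfr q (by omega)) fun q hq => hrt q (by omega)
    have l' := binVal_lt (u := u) (fun q hq => hfr q (by omega)) fun q hq => hrt' q (by omega)
    have h1 := hfr u (by omega)
    have h2 := hrt u (by omega)
    have h3 := hrt' u (by omega)
    rw [binVal, binVal, sum_range_succ, sum_range_succ, ← binVal, ← binVal] at h
    have key : binVal fr rt u = binVal fr rt' u ∧ (fr u = 1 → rt u = rt' u) := by
      interval_cases fr u <;> interval_cases rt u <;> interval_cases rt' u <;>
        simp at h ⊢ <;> omega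
    exact forall_lt_add_one (ih (fun q hq => hfr q (by omega)) (fun q hq => hrt q (by omega))
      (fun q hq => hrt' q (by omega)) key.1) key.2

/-- Loop invariant: the digits treated so far together with the carry represent the old number
formed by these digits plus one. -/
theorem advance_spec (hI : Holds I s) (hB : 13 * I.m ≤ B) (hB1 : 1 ≤ B)
    (hfr : ∀ q < I.m, s.a .free q ≤ 1) (hrt : ∀ q < I.m, s.a .route q ≤ 1) :
    Tot B I.m .advance (fun t s' => t ≤ 12 * I.m + 3 ∧ s'.v .done ≤ 1 ∧
      (∀ q < I.m, s'.a .route q ≤ 1) ∧ (∀ q < I.m, s.a .free q = 0 → s'.a .route q = s.a .route q) ∧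
      binVal (s.a .free) (s'.a .route) I.m + s'.v .done * 2 ^ rank (s.a .free) I.m =
        binVal (s.a .free) (s.a .route) I.m + 1) s := by
  refine .seq <| .const hB1 ?_
  refine .forLoop (fun r s' => s'.v .done ≤ 1 ∧ (∀ q, r ≤ q → s'.a .route q = s.a .route q) ∧
      (∀ q < I.m, s'.a .route q ≤ 1) ∧ (∀ q < I.m, s.a .free q = 0 → s'.a .route q = s.a .route q) ∧
      binVal (s.a .free) (s'.a .route) r + s'.v .done * 2 ^ rank (s.a .free) r =
        binVal (s.a .free) (s.a .route) r + 1) 10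
    rfl (by decide) (by decide) rfl rfl (by omega) (by simp [hI.demands]) (by simp [hI.one])
    ⟨by simp, by simp, by simpa using hrt, by simp, by simp [binVal, rank]⟩ ?_ ?_
  · rintro r s' hr hF hi ⟨hd, hge, hbits, hfix, hval⟩
    have hfr' : s'.a .free = s.a .free := by rw [hF.2 _ rfl]; simp
    have hone : s'.v .one = 1 := by rw [hF.1 _ rfl]; simp [hI.one]
    have hzero : s'.v .zero = 0 := by rw [hF.1 _ rfl]; simp [hI.zero]
    have hr1 := hge r le_rfl
    have hb := hrt r hr
    have e1 : binVal (s.a .free) (s.a .route) (r + 1) = binVal (s.a .free) (s.a .route) r +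
        s.a .free r * (s.a .route r * 2 ^ rank (s.a .free) r) := sum_range_succ _ _
    have e2 : rank (s.a .free) (r + 1) = rank (s.a .free) r + s.a .free r := sum_range_succ _ _
    have e3 : ∀ rt, binVal (s.a .free) rt (r + 1) = binVal (s.a .free) rt r +
        s.a .free r * (rt r * 2 ^ rank (s.a .free) r) := fun rt => sum_range_succ _ _
    have e4 : ∀ b, binVal (s.a .free) (Function.update (s'.a .route) r b) r =
        binVal (s.a .free) (s'.a .route) r := fun b => binVal_congr fun q hq =>
      Function.update_of_ne (by omega) _ _
    have hbit : ∀ b ≤ 1, ∀ q < I.m, Function.update (s'.a .route) r b q ≤ 1 := by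
      intro b hb q hq
      rw [Function.update_apply]
      split_ifs
      · exact hb
      · exact hbits q hq
    have hge' : ∀ b, ∀ q, r + 1 ≤ q → Function.update (s'.a .route) r b q = s.a .route q := by
      intro b q hq
      rw [Function.update_of_ne (by omega), hge q (by omega)]
    have hfix' : s.a .free r ≠ 0 → ∀ b, ∀ q < I.m, s.a .free q = 0 →
        Function.update (s'.a .route) r b q = s.a .route q := by
      intro hr0 b q hq h0
      rw [Function.update_of_ne (by rintro rfl; exact hr0 h0), hfix q hq h0]
    refine Tot.of_wp hB ?_
    simp only [HProg.wp, HState.setV_v, HState.setA_v, HState.setA_a, HState.setV_a, reduceCtorEq,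
      if_false, if_true, hi, hfr', hone, hzero, hr1, hr, Nat.zero_le, true_and]
    have hf := hfr r hr
    refine ⟨fun hf0 => ⟨fun hd0 => ⟨fun hx => ?_, fun hx => ?_⟩, fun hd0 => ?_⟩, fun hf0 => ?_⟩
    · refine ⟨by omega, hd, hge' _, hbit 0 (by omega), hfix' (by omega) _, ?_⟩
      have a1 : s.a .free r = 1 := by omega
      have a2 : s.a .route r = 1 := by omega
      have a3 : s'.v .done = 1 := by omega
      rw [e3, e4, e1, e2, a1, a2, a3, Function.update_self, pow_succ]
      rw [a3] at hval
      omega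
    · refine ⟨by omega, hge' _, hbit 1 le_rfl, hfix' (by omega) _, ?_⟩
      have a1 : s.a .free r = 1 := by omega
      have a2 : s.a .route r = 0 := by omega
      have a3 : s'.v .done = 1 := by omega
      rw [e3, e4, e1, a1, a2, Function.update_self]
      rw [a3] at hval
      omega
    · refine ⟨by omega, hd, fun q hq => hge q (by omega), hbits, hfix, ?_⟩
      have a3 : s'.v .done = 0 := by omega
      rw [a3] at hval ⊢
      rw [e3, e1, hr1]
      omega
    · refine ⟨by omega, hd, fun q hq => hge q (by omega), hbits, hfix, ?_⟩
      have a1 : s.a .free r = 0 := by omega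
      rw [e3, e1, e2, a1]
      simpa using hval
  · rintro t s' ht hF hi ⟨hd, -, hbits, hfix, hval⟩
    exact ⟨by omega, hd, hbits, hfix, hval⟩

end Specs

namespace HProg

/-! ### Computing the clique number of a routing -/

/-- Write the ends of all routes to the arrays `first` and `last`. -/
def orient : HProg :=
  forLoop .idQ <| seq (load .valX .loEnd .idQ) <| seq (load .valY .hiEnd .idQ) <|
    seq (load .valZ .route .idQ) <|
      cond .zero .valZ (seq (store .first .idQ .valX) (store .last .idQ .valY))
        (seq (store .first .idQ .valY) (store .last .idQ .valX))

/-- `y := pos n origin x`. -/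
def toPos (x y : Var) : HProg :=
  cond .origin x (sub y x .origin) (seq (add y x .nodes) (sub y y .origin))

/-- Compute the colour and the point of the demand `idQ` relative to the route with first node
`origin` whose last node has position `len`. -/
def classify : HProg :=
  seq (load .valX .first .idQ) <| seq (load .valY .last .idQ) <|
    seq (toPos .valX .valX) <| seq (toPos .valY .valY) <|
      cond .valY .valX
        (seq (store .ptX .idQ .valY) <| seq (store .ptY .idQ .valX) (store .color .idQ .one))
        (seq (store .ptX .idQ .valX) <| seq (store .ptY .idQ .valY) <|
          cond .valX .len
            (cond .valY .len (store .color .idQ .zero)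
              (seq (const .valZ 2) (store .color .idQ .valZ)))
            (store .color .idQ .zero))

/-- Find the point `right` of colour `2` with the least first coordinate `minX`. -/
def findRight : HProg :=
  seq (copy .right .demands) <| seq (copy .minX .big) <| forLoop .idQ <|
    seq (load .valX .color .idQ) <|
      cond .one .valX
        (seq (load .valX .ptX .idQ) <|
          cond .valX .minX (seq (copy .minX .valX) (copy .right .idQ)) skip) skip

/-- Find the point `left` with the least second coordinate `minY` among the points of colour `1`
in conflict with the point `(minX, bound)`. -/
def findLeft : HProg :=
  seq (copy .left .demands) <| seq (copy .minY .big) <| forLoop .idQ <|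
    seq (load .valX .color .idQ) <|
      cond .one .valX skip <| cond .zero .valX
        (seq (load .valX .ptX .idQ) <|
          cond .minX .valX skip <| seq (load .valY .ptY .idQ) <|
            cond .valY .bound skip <|
              cond .valY .minY (seq (copy .minY .valY) (copy .left .idQ)) skip) skip

/-- Remove a point of colour `2`, and the point of colour `1` matched to it if there is one. -/
def round : HProg :=
  seq findRight <| cond .right .demands
    (seq (load .bound .ptY .right) <| seq (store .color .right .zero) <|
      seq (add .count .count .one) <| seq findLeft <|
        cond .left .demands (store .color .left .zero) skip) skip

/-- Add the number of points of colour `1` to `count`. -/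
def countLeft : HProg :=
  forLoop .idQ <| seq (load .valX .color .idQ) <|
    cond .one .valX skip <| cond .zero .valX (add .count .count .one) skip

end HProg

/-- The result of a search for the minimum of `key` among the indices `q < u` with `P q`: the index
`f` and the value `v` of the minimum, or the defaults `m` and `big` if there is no such index. -/
def IsArgMin (P : ℕ → Prop) (key : ℕ → ℕ) (m big u f v : ℕ) : Prop :=
  (f = m ∧ v = big ∧ ∀ q < u, ¬ P q) ∨ (f < u ∧ P f ∧ v = key f ∧ ∀ q < u, P q → key f ≤ key q)

section ArgMin

variable {P : ℕ → Prop} {key : ℕ → ℕ} {m big u f v : ℕ}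

theorem IsArgMin.skip (h : IsArgMin P key m big u f v) (hP : P u → v ≤ key u ∧ key u < big) :
    IsArgMin P key m big (u + 1) f v := by
  rcases h with ⟨h1, h2, h3⟩ | ⟨h1, h2, h3, h4⟩
  · exact Or.inl ⟨h1, h2, forall_lt_add_one h3 fun hu => by have := hP hu; omega⟩
  · exact Or.inr ⟨by omega, h2, h3, forall_lt_add_one h4 fun hu => by have := hP hu; omega⟩

theorem IsArgMin.take (h : IsArgMin P key m big u f v) (hP : P u) (hlt : key u < v) :
    IsArgMin P key m big (u + 1) u (key u) := by
  refine Or.inr ⟨by omega, hP, rfl, forall_lt_add_one (fun q hq hPq => ?_) fun _ => le_rfl⟩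
  rcases h with ⟨-, -, h3⟩ | ⟨-, -, h3, h4⟩
  · exact absurd hPq (h3 q hq)
  · have := h4 q hq hPq
    omega

end ArgMin

section CliqueSpecs

variable {I : Instance} {B : ℕ} {s : HState}

open Instance

theorem findRight_spec (hI : Holds I s) (hB : 13 * I.m ≤ B)
    (hX : ∀ q < I.m, s.a .ptX q < s.v .big) :
    Tot B I.m .findRight (fun t s' => t ≤ 12 * I.m + 4 ∧
      IsArgMin (fun q => 1 < s.a .color q) (s.a .ptX) I.m (s.v .big) I.m (s'.v .right)
        (s'.v .minX)) s := by
  refine .seq <| .copy <| .seq <| .copy ?_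
  refine .forLoop (fun r s' => IsArgMin (fun q => 1 < s.a .color q) (s.a .ptX) I.m (s.v .big) r
      (s'.v .right) (s'.v .minX)) 10
    rfl (by decide) (by decide) rfl rfl (by omega) (by simp [hI.demands]) (by simp [hI.one])
    ?_ ?_ ?_
  · simp [IsArgMin, hI.demands]
  · intro r s' hr hF hi hInv
    have e1 : s'.a .color = s.a .color := by rw [hF.2 _ rfl]; simp
    have e2 : s'.a .ptX = s.a .ptX := by rw [hF.2 _ rfl]; simp
    have hone : s'.v .one = 1 := by rw [hF.1 _ rfl]; simp [hI.one]
    refine Tot.of_wp hB ?_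
    simp only [HProg.wp, HState.setV_v, HState.setV_a, reduceCtorEq, if_false, if_true, hi, hone,
      e1, e2, hr, true_and]
    refine ⟨fun hc => ⟨fun hlt => ⟨by omega, hInv.take hc hlt⟩, fun hge => ⟨by omega, ?_⟩⟩,
      fun hc => ⟨by omega, ?_⟩⟩
    · exact hInv.skip fun _ => ⟨by omega, hX r hr⟩
    · exact hInv.skip fun h => absurd h hc
  · intro t s' ht hF hi hInv
    exact ⟨by omega, hInv⟩

theorem findLeft_spec (hI : Holds I s) (hB : 13 * I.m ≤ B)
    (hY : ∀ q < I.m, s.a .ptY q < s.v .big) :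
    Tot B I.m .findLeft (fun t s' => t ≤ 17 * I.m + 4 ∧
      IsArgMin (fun q => s.a .color q = 1 ∧ s.a .ptX q ≤ s.v .minX ∧ s.v .bound ≤ s.a .ptY q)
        (s.a .ptY) I.m (s.v .big) I.m (s'.v .left) (s'.v .minY)) s := by
  refine .seq <| .copy <| .seq <| .copy ?_
  refine .forLoop (fun r s' => IsArgMin
      (fun q => s.a .color q = 1 ∧ s.a .ptX q ≤ s.v .minX ∧ s.v .bound ≤ s.a .ptY q)
      (s.a .ptY) I.m (s.v .big) r (s'.v .left) (s'.v .minY)) 15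
    rfl (by decide) (by decide) rfl rfl (by omega) (by simp [hI.demands]) (by simp [hI.one])
    ?_ ?_ ?_
  · simp [IsArgMin, hI.demands]
  · intro r s' hr hF hi hInv
    have e1 : s'.a .color = s.a .color := by rw [hF.2 _ rfl]; simp
    have e2 : s'.a .ptX = s.a .ptX := by rw [hF.2 _ rfl]; simp
    have e3 : s'.a .ptY = s.a .ptY := by rw [hF.2 _ rfl]; simp
    have e4 : s'.v .minX = s.v .minX := by rw [hF.1 _ rfl]; simp
    have e5 : s'.v .bound = s.v .bound := by rw [hF.1 _ rfl]; simp
    have hone : s'.v .one = 1 := by rw [hF.1 _ rfl]; simp [hI.one]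
    have hzero : s'.v .zero = 0 := by rw [hF.1 _ rfl]; simp [hI.zero]
    refine Tot.of_wp hB ?_
    simp only [HProg.wp, HState.setV_v, HState.setV_a, reduceCtorEq, if_false, if_true, hi, hone,
      hzero, e1, e2, e3, e4, e5, hr, true_and]
    refine ⟨fun hc => ⟨by omega, hInv.skip fun h => by omega⟩, fun hc => ⟨fun hc0 =>
      ⟨fun hx => ⟨by omega, hInv.skip fun h => by omega⟩, fun hx => ⟨fun hy => ⟨by omega,
        hInv.skip fun h => by omega⟩, fun hy => ⟨fun hlt => ⟨by omega, hInv.take ?_ hlt⟩,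
          fun hge => ⟨by omega, hInv.skip fun _ => ⟨by omega, hY r hr⟩⟩⟩⟩⟩,
      fun hc0 => ⟨by omega, hInv.skip fun h => by omega⟩⟩⟩
    omega
  · intro t s' ht hF hi hInv
    exact ⟨by omega, hInv⟩

/-- The number of points of colour `2`. -/
def numRight (m : ℕ) (c : ℕ → ℕ) : ℕ := ((range m).filter fun q => c q = 2).card

theorem numRight_update_lt {m r : ℕ} {c : ℕ → ℕ} (hr : r < m) (hc : c r = 2) :
    numRight m (Function.update c r 0) < numRight m c := by
  refine card_lt_card ((Finset.ssubset_iff_of_subset fun q hq => ?_).2 ⟨r, ?_, ?_⟩)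
  · simp only [mem_filter, Function.update_apply] at hq ⊢
    split_ifs at hq <;> simp_all
  · simp [hr, hc]
  · simp

theorem numRight_update_le (m l : ℕ) (c : ℕ → ℕ) :
    numRight m (Function.update c l 0) ≤ numRight m c := by
  refine card_le_card fun q hq => ?_
  simp only [mem_filter, Function.update_apply] at hq ⊢
  split_ifs at hq <;> simp_all

theorem update_zero_le {m r k : ℕ} {c : ℕ → ℕ} (h : ∀ q < m, c q ≤ k) :
    ∀ q < m, Function.update c r 0 q ≤ k := by
  intro q hq
  rw [Function.update_apply]
  split_ifs
  · exact Nat.zero_le _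
  · exact h q hq

/-- One round keeps the sum of `count` and the stability number of the remaining points. -/
theorem round_spec (hI : Holds I s) (hB : 13 * I.m ≤ B) (hcount : s.v .count + 1 ≤ B)
    (hc : ∀ q < I.m, s.a .color q ≤ 2)
    (hX : ∀ q < I.m, s.a .ptX q < s.v .big) (hY : ∀ q < I.m, s.a .ptY q < s.v .big) :
    Tot B I.m .round (fun t s' => t ≤ 29 * I.m + 18 ∧ (∀ q < I.m, s'.a .color q ≤ 2) ∧
      s'.v .count ≤ s.v .count + 1 ∧
      s'.v .count + alpha I.m (s'.a .color) (s.a .ptX) (s.a .ptY) =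
        s.v .count + alpha I.m (s.a .color) (s.a .ptX) (s.a .ptY) ∧
      numRight I.m (s'.a .color) ≤ numRight I.m (s.a .color) - 1) s := by
  refine .seq ((findRight_spec hI hB hX).mono fun t s₁ hF₁ ⟨ht₁, hmin₁⟩ => ?_)
  have hI₁ := hI.frame hF₁ rfl
  have c₁ : s₁.a .color = s.a .color := hF₁.2 _ rfl
  have X₁ : s₁.a .ptX = s.a .ptX := hF₁.2 _ rfl
  have Y₁ : s₁.a .ptY = s.a .ptY := hF₁.2 _ rfl
  have n₁ : s₁.v .count = s.v .count := hF₁.1 _ rfl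
  have b₁ : s₁.v .big = s.v .big := hF₁.1 _ rfl
  have two : ∀ q < I.m, s.a .color q = 2 ↔ 1 < s.a .color q := fun q hq => by
    have := hc q hq
    omega
  refine .cond (fun hlt => ?_) fun hge => ?_
  · rw [hI₁.demands] at hlt
    rcases hmin₁ with ⟨h1, -⟩ | ⟨-, hcr, hmx, hmin₁⟩
    · omega
    rw [← two _ hlt] at hcr
    have hrmin : ∀ q < I.m, s.a .color q = 2 → s.a .ptX (s₁.v .right) ≤ s.a .ptX q :=
      fun q hq h => hmin₁ q hq ((two q hq).1 h)
    refine .seq <| .load hB hlt <| .seq <| .store hB (by simpa using hlt) <| .seq <|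
      .add (by simpa [hI₁.one, n₁] using hcount) ?_
    refine .seq ((findLeft_spec ?_ hB ?_).mono fun t' s₂ hF₂ h => ?_)
    · constructor <;> simp [hI₁.demands, hI₁.nodes, hI₁.one, hI₁.zero, hI₁.big, hI₁.lo, hI₁.hi]
    · simpa [Y₁, b₁] using hY
    simp only [HState.setV_v, HState.setA_v, HState.setA_a, HState.setV_a, reduceCtorEq,
      if_false, if_true, c₁, X₁, Y₁, hI₁.zero, hmx, b₁] at h
    obtain ⟨ht₂, hmin₂⟩ := h
    have c₂ : s₂.a .color = Function.update (s.a .color) (s₁.v .right) 0 := by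
      rw [hF₂.2 _ rfl]; simp [c₁, hI₁.zero]
    have n₂ : s₂.v .count = s.v .count + 1 := by
      rw [hF₂.1 _ rfl]; simp [hI₁.one, n₁]
    have m₂ : s₂.v .demands = I.m := by rw [hF₂.1 _ rfl]; simp [hI₁.demands]
    have z₂ : s₂.v .zero = 0 := by rw [hF₂.1 _ rfl]; simp [hI₁.zero]
    refine .cond (fun hlt₂ => ?_) fun hge₂ => ?_
    · rw [m₂] at hlt₂
      rcases hmin₂ with ⟨h1, -⟩ | ⟨-, ⟨hcl, hlX, hlY⟩, -, hmin₂⟩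
      · omega
      refine .store hB hlt₂ ?_
      have hlr : s₂.v .left ≠ s₁.v .right := by
        intro e
        simp [e] at hcl
      rw [Function.update_of_ne hlr] at hcl
      simp only [HState.setA_v, HState.setA_a, if_true, n₂, c₂, z₂]
      refine ⟨by omega, update_zero_le (update_zero_le hc), le_rfl, ?_, ?_⟩
      · rw [alpha_eq_of_matched hlt₂ hlt hcl hcr hlX hlY hrmin fun l' hl' hc' hX' hY' =>
          hmin₂ l' hl' ⟨?_, hX', hY'⟩]
        · omega
        · rw [Function.update_of_ne (by rintro rfl; omega), hc']
      · have := numRight_update_lt hlt hcr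
        have := numRight_update_le I.m (s₂.v .left) (Function.update (s.a .color) (s₁.v .right) 0)
        omega
    · rw [m₂] at hge₂
      rcases hmin₂ with ⟨-, -, hno⟩ | ⟨h1, -⟩
      · refine .skip ?_
        rw [n₂, c₂]
        refine ⟨by omega, update_zero_le hc, le_rfl, ?_, ?_⟩
        · rw [alpha_eq_of_isolated hlt hcr fun l hl hc' hX' => ?_]
          · omega
          · by_contra hY'
            refine hno l hl ⟨?_, hX', by omega⟩
            rw [Function.update_of_ne (by rintro rfl; omega), hc']
        · have := numRight_update_lt hlt hcr
          omega
      · omega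
  · rw [hI₁.demands] at hge
    rcases hmin₁ with ⟨-, -, hno⟩ | ⟨h1, -⟩
    · refine .skip ?_
      rw [n₁, c₁]
      refine ⟨by omega, hc, by omega, rfl, ?_⟩
      have : numRight I.m (s.a .color) = 0 := by
        rw [numRight, card_eq_zero, filter_eq_empty_iff]
        intro q hq h2
        exact hno q (by simpa using hq) ((two q (by simpa using hq)).1 h2)
      omega
    · omega

theorem countLeft_spec (hI : Holds I s) (hB : 13 * I.m ≤ B) (hcount : s.v .count ≤ I.m) :
    Tot B I.m .countLeft (fun t s' => t ≤ 8 * I.m + 2 ∧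
      s'.v .count = s.v .count + ((range I.m).filter fun q => s.a .color q = 1).card) s := by
  refine .forLoop (fun r s' => s'.v .count = s.v .count +
      ((range r).filter fun q => s.a .color q = 1).card) 6
    rfl (by decide) (by decide) rfl rfl (by omega) (by simp [hI.demands]) (by simp [hI.one])
    (by simp) ?_ ?_
  · intro r s' hr hF hi hInv
    have e1 : s'.a .color = s.a .color := hF.2 _ rfl
    have hone : s'.v .one = 1 := by rw [hF.1 _ rfl]; simp [hI.one]
    have hzero : s'.v .zero = 0 := by rw [hF.1 _ rfl]; simp [hI.zero]
    have hle := card_filter_le (range r) fun q => s.a .color q = 1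
    rw [card_range] at hle
    refine Tot.of_wp hB ?_
    simp only [HProg.wp, HState.setV_v, reduceCtorEq, if_false, if_true, hi, hone,
      hzero, e1, hr, true_and, range_add_one, filter_insert]
    refine ⟨fun hc => ⟨by omega, ?_⟩, fun hc => ⟨fun hc0 => ⟨by omega, by omega, ?_⟩,
      fun hc0 => ⟨by omega, ?_⟩⟩⟩
    · rw [if_neg (by omega), hInv]
    · rw [if_pos (by omega), card_insert_of_notMem (by simp)]
      omega
    · rw [if_neg (by omega), hInv]
  · intro t s' ht hF hi hInv
    exact ⟨by omega, hInv⟩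

end CliqueSpecs

namespace HProg

/-- Update `cliqueVal` by the largest clique of routes that contain the first or the last arc of the
route of `idA`. -/
def arcStep : HProg :=
  seq (load .origin .first .idA) <| seq (load .valX .last .idA) <| seq (toPos .valX .len) <|
    seq (forLoop .idQ classify) <| seq (const .count 0) <| seq (forLoop .idU round) <|
      seq countLeft <| cond .cliqueVal .count (copy .cliqueVal .count) skip

/-- Compute the clique number of the current routing. -/
def cliqueProg : HProg :=
  seq orient <| seq (const .cliqueVal 0) <| forLoop .idA arcStep

end HProg

section CliqueSpecs

variable {I : Instance} {B : ℕ} {s : HState}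

open Instance

/-- The routing `R` as a sequence of bits. -/
def Instance.bits (R : I.Routing) (q : ℕ) : ℕ :=
  if h : q < I.m then (if R ⟨q, h⟩ then 1 else 0) else 0

theorem bits_fin (R : I.Routing) (q : Fin I.m) : bits R q = if R q then 1 else 0 := by
  simp [bits]

theorem bits_le (R : I.Routing) (q : ℕ) : bits R q ≤ 1 := by
  unfold bits
  split_ifs <;> simp

theorem orient_spec (hI : Holds I s) (hB : 13 * I.m ≤ B) {R : I.Routing}
    (hR : ∀ q < I.m, s.a .route q = bits R q) :
    Tot B I.m .orient (fun t s' => t ≤ 13 * I.m + 2 ∧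
      ∀ q : Fin I.m, s'.a .first q = src R q ∧ s'.a .last q = dst R q) s := by
  refine .forLoop (fun r s' => ∀ q : Fin I.m, (q : ℕ) < r →
      s'.a .first q = src R q ∧ s'.a .last q = dst R q) 11
    rfl (by decide) (by decide) rfl rfl (by omega) (by simp [hI.demands]) (by simp [hI.one])
    (by simp) ?_ ?_
  · intro r s' hr hF hi hInv
    have e1 : s'.a .loEnd r = I.lo ⟨r, hr⟩ := by rw [hF.2 _ rfl]; exact hI.lo ⟨r, hr⟩
    have e2 : s'.a .hiEnd r = I.hi ⟨r, hr⟩ := by rw [hF.2 _ rfl]; exact hI.hi ⟨r, hr⟩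
    have e3 : s'.a .route r = if R ⟨r, hr⟩ then 1 else 0 := by
      rw [hF.2 _ rfl, hR r hr, ← bits_fin]
    have hzero : s'.v .zero = 0 := by rw [hF.1 _ rfl]; simp [hI.zero]
    have key : ∀ x y, x = src R ⟨r, hr⟩ → y = dst R ⟨r, hr⟩ → ∀ q : Fin I.m, (q : ℕ) < r + 1 →
        Function.update (s'.a .first) r x q = src R q ∧
          Function.update (s'.a .last) r y q = dst R q := by
      rintro x y rfl rfl q hq
      by_cases hqr : (q : ℕ) = r
      · obtain rfl : q = ⟨r, hr⟩ := Fin.ext hqr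
        simp
      · simpa [Function.update_of_ne hqr] using hInv q (by omega)
    refine Tot.of_wp hB ?_
    simp only [HProg.wp, HState.setV_v, HState.setV_a, HState.setA_v, HState.setA_a, reduceCtorEq,
      if_false, if_true, hi, hzero, e1, e2, e3, hr, true_and]
    refine ⟨fun h => ⟨by omega, key _ _ ?_ ?_⟩, fun h => ⟨by omega, key _ _ ?_ ?_⟩⟩ <;>
      simp only [src, dst] <;> split_ifs at h ⊢ <;> simp_all
  · intro t s' ht hF hi hInv
    exact ⟨by omega, fun q => hInv q q.2⟩

theorem toPos_spec {m : ℕ} {Q : ℕ → HState → Prop} (hB : 13 * m ≤ B) {x y : Var} (hy : y ≠ .origin)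
    (hle : s.v x + s.v .nodes ≤ B)
    (h : ∀ t ≤ 3, Q t (s.setV y (pos (s.v .nodes) (s.v .origin) (s.v x)))) :
    Tot B m (.toPos x y) Q s := by
  have hset : ∀ a b, (s.setV y a).setV y b = s.setV y b := by
    intro a b
    simp [HState.setV]
  refine Tot.of_wp hB ?_
  simp only [HProg.toPos, HProg.wp, HState.setV_v, hset, hy.symm, if_false, if_true]
  refine ⟨fun hlt => ?_, fun hge => ⟨hle, ?_⟩⟩
  · have := h 2 (by omega)
    rwa [pos, if_pos hlt] at this
  · have := h 3 (by omega)
    rwa [pos, if_neg hge] at this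

theorem classify_spec (hI : Holds I s) (hB : 13 * I.m ≤ B) (hBn : 2 * I.n ≤ B) (hB2 : 2 ≤ B)
    {q : ℕ} (hq : q < I.m) (hi : s.v .idQ = q) (hf : s.a .first q ≤ I.n) (hl : s.a .last q ≤ I.n)
    {x y : ℕ} (hx : x = pos I.n (s.v .origin) (s.a .first q))
    (hy : y = pos I.n (s.v .origin) (s.a .last q)) :
    Tot B I.m .classify (fun t s' => t ≤ 20 ∧
      s'.a .color = Function.update (s.a .color) q
        (if y < x then 1 else if x < s.v .len then if y < s.v .len then 0 else 2 else 0) ∧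
      s'.a .ptX = Function.update (s.a .ptX) q (min x y) ∧
      s'.a .ptY = Function.update (s.a .ptY) q (max x y)) s := by
  refine .seq <| .load hB (by omega) <| .seq <| .load hB (by simpa [hi] using hq) <| .seq <|
    toPos_spec hB (by decide) (by simp [hi, hI.nodes]; omega) fun t ht => .seq <|
    toPos_spec hB (by decide) (by simp [hi, hI.nodes]; omega) fun t' ht' => ?_
  refine Tot.of_wp hB ?_
  simp only [HProg.wp, HState.setV_v, HState.setV_a, HState.setA_v, HState.setA_a, reduceCtorEq,
    if_false, if_true, hi, hI.nodes, hI.one, hI.zero, ← hx, ← hy, hq, true_and]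
  refine ⟨fun h => ?_, fun h => ⟨fun h' => ⟨fun h'' => ?_, fun h'' => ⟨hB2, ?_⟩⟩, fun h' => ?_⟩⟩
  · refine ⟨by omega, by rw [if_pos h], by rw [min_eq_right h.le], by rw [max_eq_left h.le]⟩
  · rw [if_neg h, if_pos h', if_pos h'', min_eq_left (by omega), max_eq_right (by omega)]
    exact ⟨by omega, rfl, rfl, rfl⟩
  · rw [if_neg h, if_pos h', if_neg h'', min_eq_left (by omega), max_eq_right (by omega)]
    exact ⟨by omega, rfl, rfl, rfl⟩
  · rw [if_neg h, if_neg h', min_eq_left (by omega), max_eq_right (by omega)]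
    exact ⟨by omega, rfl, rfl, rfl⟩

theorem classifyAll_spec (hI : Holds I s) (hB : 13 * I.m ≤ B) (hBn : 2 * I.n ≤ B) (hB2 : 2 ≤ B)
    {R : I.Routing} (hR : ∀ q : Fin I.m, s.a .first q = src R q ∧ s.a .last q = dst R q)
    {a : Fin I.m} (ho : s.v .origin = src R a) (hlen : s.v .len = pos I.n (src R a) (dst R a)) :
    Tot B I.m (.forLoop .idQ .classify) (fun t s' => t ≤ 22 * I.m + 2 ∧
      Describes R a (s'.a .color) (s'.a .ptX) (s'.a .ptY)) s := by
  refine .forLoop (fun r s' => ∀ q : Fin I.m, (q : ℕ) < r →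
      s'.a .color q = (if pos I.n (src R a) (dst R q) < pos I.n (src R a) (src R q) then 1
        else if pos I.n (src R a) (src R q) < pos I.n (src R a) (dst R a) then
          if pos I.n (src R a) (dst R q) < pos I.n (src R a) (dst R a) then 0 else 2
        else 0) ∧
      s'.a .ptX q = min (pos I.n (src R a) (src R q)) (pos I.n (src R a) (dst R q)) ∧
      s'.a .ptY q = max (pos I.n (src R a) (src R q)) (pos I.n (src R a) (dst R q))) 20
    rfl (by decide) (by decide) rfl rfl (by omega) (by simp [hI.demands]) (by simp [hI.one])
    (by simp) ?_ ?_
  · intro r s' hr hF hi hInv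
    have hI' := hI.frame hF rfl
    have b := src_dst_bounds R ⟨r, hr⟩
    have e1 : s'.a .first r = src R ⟨r, hr⟩ := by rw [hF.2 _ rfl]; exact (hR ⟨r, hr⟩).1
    have e2 : s'.a .last r = dst R ⟨r, hr⟩ := by rw [hF.2 _ rfl]; exact (hR ⟨r, hr⟩).2
    have e3 : s'.v .origin = src R a := by rw [hF.1 _ rfl, ho]
    have e4 : s'.v .len = pos I.n (src R a) (dst R a) := by rw [hF.1 _ rfl, hlen]
    refine (classify_spec hI' hB hBn hB2 hr hi (by omega) (by omega) rfl rfl).mono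
      fun t s'' hF' h => ?_
    rw [e1, e2, e3, e4] at h
    refine ⟨h.1, fun q hq => ?_⟩
    simp only [HState.setV_a, h.2.1, h.2.2.1, h.2.2.2]
    by_cases hqr : (q : ℕ) = r
    · obtain rfl : q = ⟨r, hr⟩ := Fin.ext hqr
      simp
    · simpa [Function.update_of_ne hqr] using hInv q (by omega)
  · intro t s' ht hF hi hInv
    exact ⟨by omega, ⟨fun q => (hInv q q.2).1, fun q => (hInv q q.2).2.1,
      fun q => (hInv q q.2).2.2⟩⟩

theorem rounds_spec (hI : Holds I s) (hB : 13 * I.m ≤ B) (hB1 : 1 ≤ B) (hcount : s.v .count = 0)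
    (hc : ∀ q < I.m, s.a .color q ≤ 2)
    (hX : ∀ q < I.m, s.a .ptX q < s.v .big) (hY : ∀ q < I.m, s.a .ptY q < s.v .big) :
    Tot B I.m (.forLoop .idU .round) (fun t s' => t ≤ I.m * (29 * I.m + 20) + 2 ∧
      s'.v .count ≤ I.m ∧ (∀ q < I.m, s'.a .color q ≠ 2) ∧
      s'.v .count + alpha I.m (s'.a .color) (s.a .ptX) (s.a .ptY) =
        alpha I.m (s.a .color) (s.a .ptX) (s.a .ptY)) s := by
  refine .forLoop (fun r s' => s'.v .count ≤ r ∧ (∀ q < I.m, s'.a .color q ≤ 2) ∧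
      numRight I.m (s'.a .color) ≤ I.m - r ∧
      s'.v .count + alpha I.m (s'.a .color) (s.a .ptX) (s.a .ptY) =
        alpha I.m (s.a .color) (s.a .ptX) (s.a .ptY)) (29 * I.m + 18)
    rfl (by decide) (by decide) rfl rfl (by omega) (by simp [hI.demands]) (by simp [hI.one])
    ⟨by simp [hcount], by simpa using hc, ?_, by simp [hcount]⟩ ?_ ?_
  · exact (card_filter_le _ _).trans (by simp)
  · rintro r s' hr hF hi ⟨h1, h2, h3, h4⟩
    have hI' := hI.frame hF rfl
    have e1 : s'.a .ptX = s.a .ptX := hF.2 _ rfl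
    have e2 : s'.a .ptY = s.a .ptY := hF.2 _ rfl
    have e3 : s'.v .big = s.v .big := hF.1 _ rfl
    refine (round_spec hI' hB (by omega) h2 (by rwa [e1, e3]) (by rwa [e2, e3])).mono
      fun t s'' hF' ⟨k1, k2, k3, k4, k5⟩ => ?_
    rw [e1, e2] at k4
    simp only [HState.setV_a, HState.setV_v, reduceCtorEq, if_false]
    exact ⟨k1, by omega, k2, by omega, by omega⟩
  · rintro t s' ht hF hi ⟨h1, h2, h3, h4⟩
    refine ⟨ht, h1, fun q hq hq2 => ?_, h4⟩
    rw [Nat.sub_self, Nat.le_zero, numRight, card_eq_zero, filter_eq_empty_iff] at h3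
    exact h3 (by simpa using hq) hq2

theorem arcStep_spec (hI : Holds I s) (hB : 13 * I.m ≤ B) (hBn : 2 * I.n ≤ B) (hB2 : 2 ≤ B)
    {R : I.Routing} (hR : ∀ q : Fin I.m, s.a .first q = src R q ∧ s.a .last q = dst R q)
    {a : Fin I.m} (ha : s.v .idA = a) :
    Tot B I.m .arcStep (fun t s' => t ≤ I.m * (29 * I.m + 50) + 20 ∧ ∃ c X Y, Describes R a c X Y ∧
      s'.v .cliqueVal = max (s.v .cliqueVal) (alpha I.m c X Y)) s := by
  have ba := src_dst_bounds R a
  refine .seq <| .load hB (by simp [ha]) <| .seq <| .load hB (by simp [ha]) <| .seq <|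
    toPos_spec hB (by decide) (by simp [ha, hR, hI.nodes]; omega) fun t ht => .seq ?_
  refine (classifyAll_spec (R := R) (a := a) ?_ hB hBn hB2 ?_ ?_ ?_).mono
    fun t₁ s₁ hF₁ ⟨ht₁, hdes⟩ => ?_
  · constructor <;> simp [hI.demands, hI.nodes, hI.one, hI.zero, hI.big, hI.lo, hI.hi]
  · simpa using hR
  · simp [ha, hR]
  · simp [ha, hR, hI.nodes]
  have hI₁ : Holds I s₁ := by
    refine Holds.frame (P := .forLoop .idQ .classify) ?_ hF₁ rfl
    constructor <;> simp [hI.demands, hI.nodes, hI.one, hI.zero, hI.big, hI.lo, hI.hi]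
  have v₁ : s₁.v .cliqueVal = s.v .cliqueVal := by rw [hF₁.1 _ rfl]; simp
  have hbd : ∀ q : Fin I.m,
      pos I.n (src R a) (src R q) ≤ I.n ∧ pos I.n (src R a) (dst R q) ≤ I.n := by
    intro q
    have bq := src_dst_bounds R q
    exact ⟨(pos_bounds ba.2.1 bq.1 bq.2.1).2, (pos_bounds ba.2.1 bq.2.2.1 bq.2.2.2.1).2⟩
  refine .seq <| .const (by omega) <| .seq ?_
  refine (rounds_spec ?_ hB (by omega) (by simp) ?_ ?_ ?_).mono fun t₂ s₂ hF₂ h₂ => ?_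
  · constructor <;> simp [hI₁.demands, hI₁.nodes, hI₁.one, hI₁.zero, hI₁.big, hI₁.lo, hI₁.hi]
  · intro q hq
    have := hdes.color ⟨q, hq⟩
    simp only [HState.setV_a]
    rw [this]
    split_ifs <;> omega
  · intro q hq
    have : s₁.a .ptX q = _ := hdes.fst ⟨q, hq⟩
    have := hbd ⟨q, hq⟩
    simp only [HState.setV_a, HState.setV_v, reduceCtorEq, if_false, hI₁.big]
    omega
  · intro q hq
    have : s₁.a .ptY q = _ := hdes.snd ⟨q, hq⟩
    have := hbd ⟨q, hq⟩
    simp only [HState.setV_a, HState.setV_v, reduceCtorEq, if_false, hI₁.big]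
    omega
  simp only [HState.setV_a] at h₂
  obtain ⟨ht₂, hle, hno, heq⟩ := h₂
  have hI₂ : Holds I s₂ := by
    refine Holds.frame (P := .forLoop .idU .round) ?_ hF₂ rfl
    constructor <;> simp [hI₁.demands, hI₁.nodes, hI₁.one, hI₁.zero, hI₁.big, hI₁.lo, hI₁.hi]
  have v₂ : s₂.v .cliqueVal = s.v .cliqueVal := by rw [hF₂.1 _ rfl]; simp [v₁]
  refine .seq ((countLeft_spec hI₂ hB hle).mono fun t₃ s₃ hF₃ ⟨ht₃, hcount⟩ => ?_)
  rw [← alpha_eq_card (X := s₁.a .ptX) (Y := s₁.a .ptY) hno, heq] at hcount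
  have v₃ : s₃.v .cliqueVal = s.v .cliqueVal := by rw [hF₃.1 _ rfl, v₂]
  have htime : I.m * (29 * I.m + 50) = I.m * (29 * I.m + 20) + 30 * I.m := by ring
  refine Tot.of_wp hB ?_
  simp only [HProg.wp, HState.setV_v, if_true, hcount, v₃]
  exact ⟨fun h => ⟨by omega, _, _, _, hdes, (max_eq_right h.le).symm⟩,
    fun h => ⟨by omega, _, _, _, hdes, (max_eq_left (not_lt.1 h)).symm⟩⟩

theorem cliqueProg_spec (hI : Holds I s) (hB : 13 * I.m ≤ B) (hBn : 2 * I.n ≤ B) (hB2 : 2 ≤ B)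
    (hm : 0 < I.m) {R : I.Routing} (hR : ∀ q < I.m, s.a .route q = bits R q) :
    Tot B I.m .cliqueProg (fun t s' => t ≤ 130 * I.m ^ 3 ∧ s'.v .cliqueVal = cliqueCard R) s := by
  refine .seq ((orient_spec hI hB hR).mono fun t₁ s₁ hF₁ ⟨ht₁, hR₁⟩ => ?_)
  have hI₁ := hI.frame hF₁ rfl
  refine .seq <| .const (by omega) ?_
  refine .forLoop (fun r s' => s'.v .cliqueVal ≤ cliqueCard R ∧ ∀ a : Fin I.m, (a : ℕ) < r →
      ∃ c X Y, Describes R a c X Y ∧ alpha I.m c X Y ≤ s'.v .cliqueVal) (I.m * (29 * I.m + 50) + 20)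
    rfl (by decide) (by decide) rfl rfl (by omega) (by simp [hI₁.demands]) (by simp [hI₁.one])
    (by simp) ?_ ?_
  · rintro r s' hr hF hi ⟨h1, h2⟩
    have hI' : Holds I s' := by
      refine Holds.frame (P := .forLoop .idA .arcStep) ?_ hF rfl
      constructor <;> simp [hI₁.demands, hI₁.nodes, hI₁.one, hI₁.zero, hI₁.big, hI₁.lo, hI₁.hi]
    refine (arcStep_spec hI' hB hBn hB2 (R := R) (a := ⟨r, hr⟩) ?_ hi).mono ?_
    · rw [hF.2 .first rfl, hF.2 .last rfl]
      simpa using hR₁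
    · rintro t s'' hF' ⟨ht, c, X, Y, hdes, heq⟩
      simp only [HState.setV_v, reduceCtorEq, if_false, heq]
      refine ⟨ht, max_le h1 (alpha_le_cliqueCard hdes), fun a ha => ?_⟩
      by_cases har : (a : ℕ) = r
      · obtain rfl : a = ⟨r, hr⟩ := Fin.ext har
        exact ⟨c, X, Y, hdes, le_max_right _ _⟩
      · obtain ⟨c, X, Y, hdes, hle⟩ := h2 a (by omega)
        exact ⟨c, X, Y, hdes, hle.trans (le_max_left _ _)⟩
  · rintro t s' ht hF hi ⟨h1, h2⟩
    obtain ⟨a, ha⟩ := exists_cliqueCard_le_alpha R hm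
    obtain ⟨c, X, Y, hdes, hle⟩ := h2 a a.2
    refine ⟨?_, le_antisymm h1 ((ha c X Y hdes).trans hle)⟩
    have k1 : I.m ≤ I.m ^ 2 := Nat.le_self_pow (by omega) _
    have k2 : I.m ^ 2 ≤ I.m ^ 3 := Nat.pow_le_pow_right hm (by omega)
    have k3 : I.m * (I.m * (29 * I.m + 50) + 20 + 2) = 29 * I.m ^ 3 + 50 * I.m ^ 2 + 22 * I.m := by
      ring
    omega

end CliqueSpecs

namespace HProg

/-! ### Searching for an optimal routing -/

/-- Keep the current routing if it is better than the best one so far. -/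
def keepBest : HProg :=
  cond .cliqueVal .bestVal
    (seq (copy .bestVal .cliqueVal) <| forLoop .idQ <|
      seq (load .valX .route .idQ) (store .bestRoute .idQ .valX)) skip

/-- Try all routings in which the demands parallel to `idP` are routed as forced. -/
def search : HProg :=
  seq setup <| seq (const .done 0) <| loop .done .one <|
    seq cliqueProg <| seq keepBest advance

/-- The value of the result: the sum of `bestVal` copies of the common weight. -/
def sumWeights : HProg :=
  forLoop .idQ <| cond .idQ .bestVal (add .res .res .weight) skip

/-- Copy the best routing to the output. -/
def output : HProg :=
  forLoop .idQ <| seq (load .valX .bestRoute .idQ) (store .out .idQ .valX)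

/-- The algorithm, run after the input has been copied to its arrays. -/
def main : HProg :=
  seq (add .big .nodes .one) <| seq (add .bestVal .demands .one) <| seq (forLoop .idP search) <|
    seq (const .res 0) <| seq sumWeights output

end HProg

section SearchSpecs

variable {I : Instance} {B : ℕ} {s : HState}

open Instance

/-- The best routing so far is recorded together with its clique number; the number `m + 1` stands
for the absence of a routing. -/
def Recorded (I : Instance) (s : HState) : Prop :=
  s.v .bestVal = I.m + 1 ∨
    ∃ R : I.Routing, (∀ q < I.m, s.a .bestRoute q = bits R q) ∧ s.v .bestVal = cliqueCard R

theorem keepBest_spec (hI : Holds I s) (hB : 13 * I.m ≤ B) {R : I.Routing}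
    (hR : ∀ q < I.m, s.a .route q = bits R q) (hval : s.v .cliqueVal = cliqueCard R)
    (hrec : Recorded I s) :
    Tot B I.m .keepBest (fun t s' => t ≤ 6 * I.m + 4 ∧ Recorded I s' ∧
      s'.v .bestVal ≤ s.v .bestVal ∧ s'.v .bestVal ≤ cliqueCard R) s := by
  refine .cond (fun hlt => .seq <| .copy ?_) fun hge => .skip ⟨by omega, hrec, le_rfl, by omega⟩
  refine .forLoop (fun r s' => ∀ q < r, s'.a .bestRoute q = bits R q) 4
    rfl (by decide) (by decide) rfl rfl (by omega) (by simp [hI.demands]) (by simp [hI.one])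
    (by simp) ?_ ?_
  · intro r s' hr hF hi hInv
    have e1 : s'.a .route r = bits R r := by rw [hF.2 _ rfl]; simpa using hR r hr
    refine Tot.of_wp hB ?_
    simp only [HProg.wp, HState.setV_v, HState.setV_a, HState.setA_a, reduceCtorEq,
      if_false, if_true, hi, e1, hr, true_and]
    refine ⟨by omega, forall_lt_add_one (fun q hq => ?_) (Function.update_self ..)⟩
    rw [Function.update_of_ne (by omega), hInv q hq]
  · intro t s' ht hF hi hInv
    have e : s'.v .bestVal = cliqueCard R := by rw [hF.1 _ rfl]; simp [hval]
    exact ⟨by omega, Or.inr ⟨R, hInv, e⟩, by omega, by omega⟩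

/-- The routings tried for `p`: those that send every demand of `D(p)` along its side of `p`. -/
def Instance.Compatible (p : Fin I.m) (R : I.Routing) : Prop :=
  ∀ q ∈ I.parallelTo p, R q = forced p q

theorem exists_routing_of_bits {f : ℕ → ℕ} (h : ∀ q < I.m, f q ≤ 1) :
    ∃ R : I.Routing, ∀ q < I.m, f q = bits R q := by
  refine ⟨fun q => decide (f q = 1), fun q hq => ?_⟩
  have := h q hq
  simp only [bits, hq, dif_pos, decide_eq_true_eq]
  split_ifs <;> omega

theorem bits_injective {R R' : I.Routing} (h : ∀ q < I.m, bits R q = bits R' q) : R = R' := by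
  funext q
  have := h q q.2
  rw [bits_fin, bits_fin] at this
  split_ifs at this <;> simp_all

/-- Loop invariant: the current routing is compatible with `p`, and all compatible routings with a
smaller binary number have been compared with the best one. -/
theorem search_spec (hI : Holds I s) (hB : 13 * I.m ≤ B) (hBn : 2 * I.n ≤ B) (hB2 : 2 ≤ B)
    {p : Fin I.m} (hp : s.v .idP = p) (hrec : Recorded I s) :
    Tot B I.m .search (fun t s' => t ≤ 193 * (2 ^ I.k * I.m ^ 3) ∧ Recorded I s' ∧
      s'.v .bestVal ≤ s.v .bestVal ∧ ∀ R, Compatible p R → s'.v .bestVal ≤ cliqueCard R) s := by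
  have hm : 0 < I.m := p.pos
  refine .seq ((setup_spec hI hB (by omega) hp).mono fun t₁ s₁ hF₁ ⟨ht₁, hset⟩ => ?_)
  have hI₁ := hI.frame hF₁ rfl
  obtain ⟨fr, hfr⟩ : ∃ fr, fr = s₁.a .free := ⟨_, rfl⟩
  rw [← hfr] at hset
  have hfr1 : ∀ q < I.m, fr q ≤ 1 := fun q hq => by
    have := (hset ⟨q, hq⟩).1
    simp only at this
    rw [this]
    split_ifs <;> omega
  have hrank : rank fr I.m ≤ I.k := by
    rw [rank, ← Fin.sum_univ_eq_sum_range, sum_congr rfl fun q _ => (hset q).1]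
    have : (univ \ I.parallelTo p).card ≤ I.k :=
      Finset.le_sup (f := fun p => (univ \ I.parallelTo p).card) (mem_univ p)
    refine le_trans (le_of_eq ?_) this
    rw [card_eq_sum_ones, ← sum_filter_add_sum_filter_not univ (· ∈ I.parallelTo p),
      sum_congr rfl fun q hq => if_pos (mem_filter.1 hq).2, sum_const_zero, zero_add,
      sum_congr rfl fun q hq => if_neg (mem_filter.1 hq).2]
    congr 1
    ext q
    simp
  have hRange : ∀ R : I.Routing, binVal fr (bits R) I.m < 2 ^ rank fr I.m := fun R =>
    binVal_lt hfr1 fun q _ => bits_le R q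
  have hInj : ∀ R R' : I.Routing, Compatible p R → Compatible p R' →
      binVal fr (bits R) I.m = binVal fr (bits R') I.m → R = R' := by
    intro R R' hR hR' h
    refine bits_injective fun q hq => ?_
    have h1 := hset ⟨q, hq⟩
    by_cases hpar : (⟨q, hq⟩ : Fin I.m) ∈ I.parallelTo p
    · have := bits_fin R ⟨q, hq⟩
      have := bits_fin R' ⟨q, hq⟩
      simp_all [hR _ hpar, hR' _ hpar]
    · exact binVal_inj hfr1 (fun q _ => bits_le R q) (fun q _ => bits_le R' q) h q hq
        (by simpa [hpar] using h1.1)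
  have v₁ : s₁.v .bestVal = s.v .bestVal := hF₁.1 _ rfl
  have b₁ : s₁.a .bestRoute = s.a .bestRoute := hF₁.2 _ rfl
  refine .seq <| .const (by omega) ?_
  -- the variant is the number of routings that have not been tried yet
  refine .loop (Inv := fun s' => ∃ R : I.Routing, Compatible p R ∧
      (∀ q < I.m, s'.a .route q = bits R q) ∧ Recorded I s' ∧ s'.v .bestVal ≤ s.v .bestVal ∧
      s'.v .done ≤ 1 ∧ ∀ R', Compatible p R' →
        (s'.v .done = 1 ∨ binVal fr (bits R') I.m < binVal fr (bits R) I.m) →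
        s'.v .bestVal ≤ cliqueCard R')
    (V := fun s' => if s'.v .done = 0 then 2 ^ rank fr I.m - binVal fr (s'.a .route) I.m else 0)
    (T := 160 * I.m ^ 3) ?_ ?_ ?_
  · obtain ⟨R, hR⟩ := exists_routing_of_bits (I := I) (f := s₁.a .route) fun q hq => by
      have := (hset ⟨q, hq⟩).2
      simp only at this
      rw [this]
      split_ifs <;> omega
    refine ⟨R, fun q hq => ?_, by simpa using hR, ?_, by simp [v₁], by simp, ?_⟩
    · have h1 := (hset q).2
      rw [hR q q.2, bits_fin, if_pos hq] at h1
      split_ifs at h1 <;> simp_all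
    · simpa [Recorded, v₁, b₁] using hrec
    · intro R' hR' h
      have hzero : binVal fr (bits R) I.m = 0 := by
        refine sum_eq_zero fun q hq => ?_
        have hq' : q < I.m := by simpa using hq
        have h1 := hset ⟨q, hq'⟩
        simp only at h1
        rw [← hR q hq', h1.1, h1.2]
        split_ifs <;> simp
      simp [hzero] at h
  · rintro s₂ ⟨R, hRc, hR, hrec₂, hle₂, hd₂, hall⟩ hF₂ hlt
    have hI₂ : Holds I s₂ := by
      refine Holds.frame (P := .loop .done .one (.seq .cliqueProg (.seq .keepBest .advance))) ?_
        hF₂ rfl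
      constructor <;> simp [hI₁.demands, hI₁.nodes, hI₁.one, hI₁.zero, hI₁.big, hI₁.lo, hI₁.hi]
    rw [hI₂.one] at hlt
    have f₂ : s₂.a .free = fr := (hF₂.2 _ rfl).trans hfr.symm
    refine .seq ((cliqueProg_spec hI₂ hB hBn hB2 hm hR).mono fun t₃ s₃ hF₃ ⟨ht₃, hval⟩ => ?_)
    have r₃ : s₃.a .route = s₂.a .route := hF₃.2 _ rfl
    have v₃ : s₃.v .bestVal = s₂.v .bestVal := hF₃.1 _ rfl
    have b₃ : s₃.a .bestRoute = s₂.a .bestRoute := hF₃.2 _ rfl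
    have hI₃ := hI₂.frame hF₃ rfl
    refine .seq ((keepBest_spec hI₃ hB (R := R) (by rwa [r₃]) hval
      (by simpa [Recorded, v₃, b₃] using hrec₂)).mono fun t₄ s₄ hF₄ ⟨ht₄, hrec₄, hle₄, hleR⟩ => ?_)
    have r₄ : s₄.a .route = s₂.a .route := (hF₄.2 _ rfl).trans r₃
    have f₄ : s₄.a .free = fr := ((hF₄.2 _ rfl).trans (hF₃.2 _ rfl)).trans f₂
    have hI₄ := hI₃.frame hF₄ rfl
    refine (advance_spec hI₄ hB (by omega) (by rwa [f₄]) fun q hq => ?_).mono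
      fun t₅ s₅ hF₅ ⟨ht₅, hd₅, hbits₅, hfix₅, hval₅⟩ => ?_
    · rw [r₄, hR q hq]
      exact bits_le R q
    have v₅ : s₅.v .bestVal = s₄.v .bestVal := hF₅.1 _ rfl
    have b₅ : s₅.a .bestRoute = s₄.a .bestRoute := hF₅.2 _ rfl
    obtain ⟨R₅, hR₅⟩ := exists_routing_of_bits hbits₅
    rw [f₄, r₄, binVal_congr hR₅, binVal_congr hR] at hval₅
    have hR₅c : Compatible p R₅ := by
      intro q hq
      have h1 : fr q = 0 := by rw [(hset q).1, if_pos hq]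
      have h2 := hfix₅ q q.2 (by rw [f₄, h1])
      rw [r₄, hR₅ q q.2, hR q q.2, bits_fin, bits_fin, hRc q hq] at h2
      split_ifs at h2 <;> simp_all
    have hlt₅ := hRange R₅
    have hltR := hRange R
    refine ⟨?_, ⟨R₅, hR₅c, hR₅, ?_, by omega, hd₅, ?_⟩, ?_⟩
    · have : I.m ≤ I.m ^ 3 := Nat.le_self_pow (by omega) _
      have : 1 ≤ I.m ^ 3 := Nat.one_le_pow _ _ hm
      omega
    · simpa [Recorded, v₅, b₅] using hrec₄
    · intro R' hR' h
      have hR'lt := hRange R'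
      have hle : binVal fr (bits R') I.m < binVal fr (bits R) I.m + 1 := by
        rcases h with h | h
        · rw [h] at hval₅
          omega
        · have : s₅.v .done = 0 ∨ s₅.v .done = 1 := by omega
          rcases this with h0 | h0 <;> rw [h0] at hval₅ <;> omega
      rcases Nat.lt_succ_iff_lt_or_eq.1 hle with h' | h'
      · have := hall R' hR' (Or.inr h')
        omega
      · obtain rfl := hInj R' R hR' hRc h'
        omega
    · have hd₂' : s₂.v .done = 0 := by omega
      have : s₅.v .done = 0 ∨ s₅.v .done = 1 := by omega
      rw [binVal_congr hR₅, binVal_congr hR]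
      rcases this with h0 | h0
      · simp only [hd₂', h0, if_true]
        rw [h0] at hval₅
        omega
      · simp only [hd₂', h0, one_ne_zero, if_true, if_false]
        omega
  · rintro t s₂ ht hF₂ ⟨R, hRc, hR, hrec₂, hle₂, hd₂, hall⟩ hge
    have hone : s₂.v .one = 1 := by rw [hF₂.1 _ rfl]; simp [hI₁.one]
    refine ⟨?_, hrec₂, hle₂, fun R' hR' => hall R' hR' (Or.inl (by omega))⟩
    have h1 : 2 ^ rank fr I.m ≤ 2 ^ I.k := Nat.pow_le_pow_right (by omega) hrank
    have h2 : I.m ≤ I.m ^ 3 := Nat.le_self_pow (by omega) _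
    have h3 : 1 ≤ I.m ^ 3 := Nat.one_le_pow _ _ hm
    have h4 : 1 * I.m ^ 3 ≤ 2 ^ I.k * I.m ^ 3 := Nat.mul_le_mul_right _ Nat.one_le_two_pow
    have h5 : 2 ^ I.k * 1 ≤ 2 ^ I.k * I.m ^ 3 := Nat.mul_le_mul_left _ h3
    have h6 : (if (s₁.setV .done 0).v .done = 0 then
        2 ^ rank fr I.m - binVal fr ((s₁.setV .done 0).a .route) I.m else 0) *
        (160 * I.m ^ 3 + 1) ≤ 2 ^ I.k * (160 * I.m ^ 3 + 1) := by
      refine Nat.mul_le_mul_right _ ?_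
      split_ifs <;> omega
    have h7 : 2 ^ I.k * (160 * I.m ^ 3 + 1) = 160 * (2 ^ I.k * I.m ^ 3) + 2 ^ I.k := by ring
    omega

theorem sumWeights_spec (hI : Holds I s) (hB : 13 * I.m ≤ B) (hBw : I.m * s.v .weight ≤ B)
    (hres : s.v .res = 0) :
    Tot B I.m .sumWeights (fun t s' => t ≤ 4 * I.m + 2 ∧
      s'.v .res = min I.m (s.v .bestVal) * s.v .weight) s := by
  refine .forLoop (fun r s' => s'.v .res = min r (s.v .bestVal) * s.v .weight) 2
    rfl (by decide) (by decide) rfl rfl (by omega) (by simp [hI.demands]) (by simp [hI.one])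
    (by simp [hres]) ?_ ?_
  · intro r s' hr hF hi hInv
    have e1 : s'.v .bestVal = s.v .bestVal := hF.1 _ rfl
    have e2 : s'.v .weight = s.v .weight := hF.1 _ rfl
    refine Tot.of_wp hB ?_
    simp only [HProg.wp, HState.setV_v, reduceCtorEq, if_false, if_true, hi, hInv, e1, e2]
    refine ⟨fun h => ?_, fun h => ⟨by omega, ?_⟩⟩
    · have h1 : (r + 1) * s.v .weight ≤ I.m * s.v .weight := Nat.mul_le_mul_right _ hr
      rw [min_eq_left h.le, min_eq_left (by omega), add_mul, one_mul] at *
      exact ⟨by omega, by omega, rfl⟩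
    · rw [min_eq_right (by omega), min_eq_right (by omega)]
  · intro t s' ht hF hi hInv
    exact ⟨by omega, hInv⟩

theorem output_spec (hI : Holds I s) (hB : 13 * I.m ≤ B) :
    Tot B I.m .output (fun t s' => t ≤ 6 * I.m + 2 ∧
      ∀ q < I.m, s'.a .out q = s.a .bestRoute q) s := by
  refine .forLoop (fun r s' => ∀ q < r, s'.a .out q = s.a .bestRoute q) 4
    rfl (by decide) (by decide) rfl rfl (by omega) (by simp [hI.demands]) (by simp [hI.one])
    (by simp) ?_ ?_
  · intro r s' hr hF hi hInv
    have e1 : s'.a .bestRoute = s.a .bestRoute := hF.2 _ rfl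
    refine Tot.of_wp hB ?_
    simp only [HProg.wp, HState.setV_v, HState.setV_a, HState.setA_a, reduceCtorEq,
      if_false, if_true, hi, e1, hr, true_and]
    refine ⟨by omega, forall_lt_add_one (fun q hq => ?_) (Function.update_self ..)⟩
    rw [Function.update_of_ne (by omega), hInv q hq]
  · intro t s' ht hF hi hInv
    exact ⟨by omega, hInv⟩

theorem main_spec (hdem : s.v .demands = I.m) (hnod : s.v .nodes = I.n) (hone : s.v .one = 1)
    (hzero : s.v .zero = 0) (hlo : ∀ q : Fin I.m, s.a .loEnd q = I.lo q)
    (hhi : ∀ q : Fin I.m, s.a .hiEnd q = I.hi q) (hB : 13 * I.m + 2 ≤ B) (hBn : 2 * I.n + 1 ≤ B)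
    {c : ℕ} (hc : 0 < I.m → s.v .weight = c) (hBw : I.m * s.v .weight ≤ B) :
    Tot B I.m .main (fun t s' => t ≤ 210 * (2 ^ I.k * I.m ^ 4) + 12 ∧
      ∃ R : I.Routing, (∀ q < I.m, s'.a .out q = bits R q) ∧
        (∀ R' : I.Routing, cliqueCard R ≤ cliqueCard R') ∧ s'.v .res = cliqueCard R * c) s := by
  refine .seq <| .add (by omega) <| .seq <| .add (by simp [hdem, hone]; omega) <| .seq ?_
  have hI : ∀ x, Holds I (((s.setV .big (s.v .nodes + s.v .one)).setV .bestVal x)) := by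
    intro x
    constructor <;> simp [hdem, hnod, hone, hzero, hlo, hhi]
  refine .forLoop (fun r s' => Recorded I s' ∧ ∀ p : Fin I.m, (p : ℕ) < r → ∀ R, Compatible p R →
      s'.v .bestVal ≤ cliqueCard R) (193 * (2 ^ I.k * I.m ^ 3))
    rfl (by decide) (by decide) rfl rfl (by omega) (hI _).demands (hI _).one
    (by simp [Recorded, hdem, hone]) ?_ ?_
  · rintro r s' hr hF hi ⟨hrec, hInv⟩
    refine (search_spec ((hI _).frame hF rfl) (by omega) (by omega) (by omega)
      (p := ⟨r, hr⟩) hi hrec).mono fun t s'' hF' ⟨ht, hrec', hle, hall⟩ => ?_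
    refine ⟨ht, by simpa [Recorded] using hrec', fun p hp R hR => ?_⟩
    simp only [HState.setV_v, reduceCtorEq, if_false]
    by_cases hpr : (p : ℕ) = r
    · obtain rfl : p = ⟨r, hr⟩ := Fin.ext hpr
      exact hall R hR
    · exact hle.trans (hInv p (by omega) R hR)
  · rintro t₁ s₁ ht₁ hF₁ - ⟨hrec, hall⟩
    have hI₁ := (hI _).frame hF₁ rfl
    have w₁ : s₁.v .weight = s.v .weight := by rw [hF₁.1 _ rfl]; simp
    refine .seq <| .const (by omega) <| .seq ?_
    have hI₁' : Holds I (s₁.setV .res 0) := by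
      constructor <;> simp [hI₁.demands, hI₁.nodes, hI₁.one, hI₁.zero, hI₁.big, hI₁.lo, hI₁.hi]
    refine (sumWeights_spec hI₁' (by omega) (by simpa [w₁] using hBw) (by simp)).mono
      fun t₂ s₂ hF₂ ⟨ht₂, hres⟩ => ?_
    have hI₂ := hI₁'.frame hF₂ rfl
    refine (output_spec hI₂ (by omega)).mono fun t₃ s₃ hF₃ ⟨ht₃, hout⟩ => ?_
    have res₃ : s₃.v .res = s₂.v .res := hF₃.1 _ rfl
    have b₂ : s₂.a .bestRoute = s₁.a .bestRoute := by rw [hF₂.2 _ rfl]; simp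
    simp only [HState.setV_v, reduceCtorEq, if_false, w₁] at hres
    rw [res₃, hres]
    constructor
    · have e : I.m * (193 * (2 ^ I.k * I.m ^ 3) + 2) = 193 * (2 ^ I.k * I.m ^ 4) + 2 * I.m := by
        ring
      have h2 : I.m ≤ I.m ^ 4 := Nat.le_self_pow (by omega) _
      have h4 : 1 * I.m ^ 4 ≤ 2 ^ I.k * I.m ^ 4 := Nat.mul_le_mul_right _ Nat.one_le_two_pow
      omega
    rcases Nat.eq_zero_or_pos I.m with hm | hm
    · have hzero : ∀ R : I.Routing, cliqueCard R = 0 := fun R => by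
        have := cliqueCard_le R
        omega
      exact ⟨fun _ => true, by omega, fun R' => by simp [hzero], by simp [hm, hzero]⟩
    · obtain ⟨R₀, p, hopt, hforced⟩ := exists_optimal_forced hm
      have hle := hall p p.2 R₀ hforced
      have hR₀ := cliqueCard_le R₀
      rcases hrec with hrec | ⟨R, hR, hval⟩
      · omega
      · refine ⟨R, fun q hq => by rw [hout q hq, b₂, hR q hq], fun R' => ?_, ?_⟩
        · have := hopt R'
          omega
        · rw [hc hm, min_eq_right (by omega), hval]

end SearchSpecs

/-! ### Reading the input -/

/-- Write the multiples `0, m, …, j * m` to the registers from `40` on. -/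
def initBases : ℕ → Prog
  | 0 => .const 40 0
  | j + 1 => .seq (initBases j) (.add (41 + j) (40 + j) 1)

/-- Copy the ends of the demand with the number in register `7` from the cells from `reg 6` on to
the arrays `loEnd` and `hiEnd`, and go on to the next demand. -/
def copyEnds : Prog :=
  .seq (.load 8 6) <| .seq (.add 39 43 7) <| .seq (.store 39 8) <| .seq (.add 6 6 3) <|
    .seq (.load 8 6) <| .seq (.add 39 44 7) <| .seq (.store 39 8) <| .seq (.add 6 6 3) <|
      .seq (.add 6 6 3) (.add 7 7 3)

/-- Bring the input into the form expected by `HProg.main`. -/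
def readInput : Prog :=
  .seq (.copy 2 0) <| .seq (.const 3 1) <| .seq (initBases 12) <| .seq (.const 6 2) <|
    .seq (.load 5 6) <| .seq (.const 6 0) (.loop 7 1 copyEnds)

/-- All numbers in the state are at most `B`. -/
def State.BoundedBy (B : ℕ) (σ : State) : Prop := (∀ x, σ.reg x ≤ B) ∧ ∀ i, σ.mem i ≤ B

section ReadInput

variable {I : Instance} {B : ℕ} {σ : State}

theorem State.BoundedBy.setReg (h : σ.BoundedBy B) (x : ℕ) {r : ℕ} (hr : r ≤ B) :
    (σ.setReg x r).BoundedBy B := by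
  refine ⟨fun y => ?_, h.2⟩
  simp only [State.setReg, Function.update_apply]
  split_ifs
  · exact hr
  · exact h.1 y

theorem State.BoundedBy.setMem (h : σ.BoundedBy B) (i : ℕ) {r : ℕ} (hr : r ≤ B) :
    (σ.setMem i r).BoundedBy B := by
  refine ⟨h.1, fun y => ?_⟩
  simp only [State.setMem, Function.update_apply]
  split_ifs
  · exact hr
  · exact h.2 y

theorem initBases_spec {m : ℕ} (hσ : σ.BoundedBy B) (hm : σ.reg 1 = m) (j : ℕ) (hB : j * m ≤ B) :
    ∃ t τ, Exec B (initBases j) σ t τ ∧ t ≤ j + 1 ∧ τ.BoundedBy B ∧ τ.mem = σ.mem ∧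
      (∀ x < 40, τ.reg x = σ.reg x) ∧ ∀ i ≤ j, τ.reg (40 + i) = i * m := by
  induction j with
  | zero =>
    refine ⟨_, _, .const σ 40 0 (Nat.zero_le _), by omega, hσ.setReg 40 (Nat.zero_le _), rfl,
      fun x hx => ?_, fun i hi => ?_⟩
    · simp [State.setReg, Function.update_of_ne hx.ne]
    · obtain rfl : i = 0 := by omega
      simp [State.setReg]
  | succ j ih =>
    rw [add_mul, one_mul] at hB
    obtain ⟨t, τ, h1, h2, h3, h4, h5, h6⟩ := ih (by omega)
    have e : τ.reg (40 + j) + τ.reg 1 = j * m + m := by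
      rw [h6 j le_rfl, h5 1 (by omega), hm]
    refine ⟨_, _, .seq h1 (.add τ (41 + j) (40 + j) 1 (by omega)), by omega,
      h3.setReg _ (by omega), h4, fun x hx => ?_, fun i hi => ?_⟩
    · simp only [State.setReg]
      rw [Function.update_of_ne (by omega), h5 x hx]
    · simp only [State.setReg]
      by_cases hij : i = j + 1
      · subst hij
        rw [show 40 + (j + 1) = 41 + j by omega, Function.update_self, e, add_mul, one_mul]
      · rw [Function.update_of_ne (by omega), h6 i (by omega)]

/-- The loop of `readInput` after `r` demands have been copied. -/
structure Copied (I : Instance) (B r : ℕ) (σ : State) : Prop where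
  bounded : σ.BoundedBy B
  demands : σ.reg 1 = I.m
  nodes : σ.reg 2 = I.n
  one : σ.reg 3 = 1
  zero : σ.reg 4 = 0
  weight : σ.reg 5 = I.input.mem 2
  source : σ.reg 6 = 3 * r
  counter : σ.reg 7 = r
  base : ∀ i ≤ 12, σ.reg (40 + i) = i * I.m
  input : ∀ i < 3 * I.m, σ.mem i = I.input.mem i
  lo : ∀ q : Fin I.m, (q : ℕ) < r → σ.mem (3 * I.m + q) = I.lo q
  hi : ∀ q : Fin I.m, (q : ℕ) < r → σ.mem (4 * I.m + q) = I.hi q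

theorem input_mem_lo (q : Fin I.m) : I.input.mem (3 * q) = I.lo q := by
  have h : 3 * (q : ℕ) / 3 = q := by omega
  simp [Instance.input, h]

theorem input_mem_hi (q : Fin I.m) : I.input.mem (3 * q + 1) = I.hi q := by
  have h : (3 * (q : ℕ) + 1) / 3 = q := by omega
  have h' : (3 * (q : ℕ) + 1) % 3 = 1 := by omega
  simp [Instance.input, h, h']

theorem copyEnds_spec (hB : 13 * I.m ≤ B) {r : ℕ} (hr : r < I.m) (h : Copied I B r σ) :
    ∃ t τ, Exec B copyEnds σ t τ ∧ t ≤ 10 ∧ Copied I B (r + 1) τ := by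
  have hlo := input_mem_lo (⟨r, hr⟩ : Fin I.m)
  have hhi := input_mem_hi (⟨r, hr⟩ : Fin I.m)
  simp only at hlo hhi
  have e1 : σ.mem (3 * r) = I.lo ⟨r, hr⟩ := (h.input _ (by omega)).trans hlo
  have e2 : σ.mem (3 * r + 1) = I.hi ⟨r, hr⟩ := (h.input _ (by omega)).trans hhi
  have b1 : I.lo ⟨r, hr⟩ ≤ B := e1 ▸ h.bounded.2 _
  have b2 : I.hi ⟨r, hr⟩ ≤ B := e2 ▸ h.bounded.2 _
  have base3 := h.base 3 (by omega)
  have base4 := h.base 4 (by omega)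
  simp only [Nat.reduceAdd] at base3 base4
  have ne1 : 3 * r + 1 ≠ 3 * I.m + r := by omega
  -- the state after each instruction
  let σ₁ := σ.setReg 8 (I.lo ⟨r, hr⟩)
  let σ₂ := σ₁.setReg 39 (3 * I.m + r)
  let σ₃ := σ₂.setMem (3 * I.m + r) (I.lo ⟨r, hr⟩)
  let σ₄ := σ₃.setReg 6 (3 * r + 1)
  let σ₅ := σ₄.setReg 8 (I.hi ⟨r, hr⟩)
  let σ₆ := σ₅.setReg 39 (4 * I.m + r)
  let σ₇ := σ₆.setMem (4 * I.m + r) (I.hi ⟨r, hr⟩)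
  let σ₈ := σ₇.setReg 6 (3 * r + 2)
  let σ₉ := σ₈.setReg 6 (3 * r + 3)
  let τ := σ₉.setReg 7 (r + 1)
  have x1 : Exec B (.load 8 6) σ 1 σ₁ := by
    have := Exec.load (B := B) σ 8 6 (h.bounded.2 _)
    rwa [h.source, e1] at this
  have x2 : Exec B (.add 39 43 7) σ₁ 1 σ₂ := by
    have := Exec.add (B := B) σ₁ 39 43 7
    simp only [σ₁, State.setReg, Function.update_apply, Nat.reduceEqDiff, if_false, base3,
      h.counter] at this
    exact this (by omega)
  have x3 : Exec B (.store 39 8) σ₂ 1 σ₃ := by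
    have := Exec.store (B := B) σ₂ 39 8
    simp only [σ₂, σ₁, State.setReg, Function.update_apply, Nat.reduceEqDiff, if_false,
      if_true] at this
    exact this b1
  have x4 : Exec B (.add 6 6 3) σ₃ 1 σ₄ := by
    have := Exec.add (B := B) σ₃ 6 6 3
    simp only [σ₃, σ₂, σ₁, State.setReg, State.setMem, Function.update_apply, Nat.reduceEqDiff,
      if_false, h.source, h.one] at this
    exact this (by omega)
  have x5 : Exec B (.load 8 6) σ₄ 1 σ₅ := by
    have := Exec.load (B := B) σ₄ 8 6
    simp only [σ₄, σ₃, σ₂, σ₁, State.setReg, State.setMem, Function.update_apply,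
      if_true, ne1, if_false, e2] at this
    exact this b2
  have x6 : Exec B (.add 39 44 7) σ₅ 1 σ₆ := by
    have := Exec.add (B := B) σ₅ 39 44 7
    simp only [σ₅, σ₄, σ₃, σ₂, σ₁, State.setReg, State.setMem, Function.update_apply,
      Nat.reduceEqDiff, if_false, base4, h.counter] at this
    exact this (by omega)
  have x7 : Exec B (.store 39 8) σ₆ 1 σ₇ := by
    have := Exec.store (B := B) σ₆ 39 8
    simp only [σ₆, σ₅, State.setReg, Function.update_apply, Nat.reduceEqDiff, if_false,
      if_true] at this
    exact this b2
  have x8 : Exec B (.add 6 6 3) σ₇ 1 σ₈ := by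
    have := Exec.add (B := B) σ₇ 6 6 3
    simp only [σ₇, σ₆, σ₅, σ₄, σ₃, σ₂, σ₁, State.setReg, State.setMem, Function.update_apply,
      Nat.reduceEqDiff, if_false, if_true, h.one] at this
    exact this (by omega)
  have x9 : Exec B (.add 6 6 3) σ₈ 1 σ₉ := by
    have := Exec.add (B := B) σ₈ 6 6 3
    simp only [σ₈, σ₇, σ₆, σ₅, σ₄, σ₃, σ₂, σ₁, State.setReg, State.setMem, Function.update_apply,
      Nat.reduceEqDiff, if_false, if_true, h.one] at this
    exact this (by omega)
  have x10 : Exec B (.add 7 7 3) σ₉ 1 τ := by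
    have := Exec.add (B := B) σ₉ 7 7 3
    simp only [σ₉, σ₈, σ₇, σ₆, σ₅, σ₄, σ₃, σ₂, σ₁, State.setReg, State.setMem,
      Function.update_apply, Nat.reduceEqDiff, if_false, h.one, h.counter] at this
    exact this (by omega)
  have hreg : ∀ x, x ≠ 6 → x ≠ 7 → x ≠ 8 → x ≠ 39 → τ.reg x = σ.reg x := by
    intro x h6 h7 h8 h39
    simp [τ, σ₉, σ₈, σ₇, σ₆, σ₅, σ₄, σ₃, σ₂, σ₁, State.setReg, State.setMem, h6, h7, h8, h39]
  have hmem : ∀ i, τ.mem i = if i = 4 * I.m + r then I.hi ⟨r, hr⟩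
      else if i = 3 * I.m + r then I.lo ⟨r, hr⟩ else σ.mem i := by
    intro i
    simp [τ, σ₉, σ₈, σ₇, σ₆, σ₅, σ₄, σ₃, σ₂, σ₁, State.setReg, State.setMem,
      Function.update_apply]
  refine ⟨_, τ, .seq x1 <| .seq x2 <| .seq x3 <| .seq x4 <| .seq x5 <| .seq x6 <| .seq x7 <|
    .seq x8 <| .seq x9 x10, by omega, ?_⟩
  constructor
  · exact (((((((((h.bounded.setReg _ b1).setReg _ (by omega)).setMem _ b1).setReg _
      (by omega)).setReg _ b2).setReg _ (by omega)).setMem _ b2).setReg _ (by omega)).setReg _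
      (by omega)).setReg _ (by omega)
  · rw [hreg 1 (by omega) (by omega) (by omega) (by omega), h.demands]
  · rw [hreg 2 (by omega) (by omega) (by omega) (by omega), h.nodes]
  · rw [hreg 3 (by omega) (by omega) (by omega) (by omega), h.one]
  · rw [hreg 4 (by omega) (by omega) (by omega) (by omega), h.zero]
  · rw [hreg 5 (by omega) (by omega) (by omega) (by omega), h.weight]
  · simp [τ, σ₉, State.setReg]
    omega
  · simp [τ, State.setReg]
  · intro i hi
    rw [hreg _ (by omega) (by omega) (by omega) (by omega), h.base i hi]
  · intro i hi
    rw [hmem, if_neg (by omega), if_neg (by omega), h.input i hi]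
  · intro q hq
    rw [hmem, if_neg (by omega)]
    by_cases hqr : (q : ℕ) = r
    · obtain rfl : q = ⟨r, hr⟩ := Fin.ext hqr
      rw [if_pos rfl]
    · rw [if_neg (by omega), h.lo q (by omega)]
  · intro q hq
    rw [hmem]
    by_cases hqr : (q : ℕ) = r
    · obtain rfl : q = ⟨r, hr⟩ := Fin.ext hqr
      rw [if_pos rfl]
    · rw [if_neg (by omega), if_neg (by omega), h.hi q (by omega)]

theorem copyLoop_spec (hB : 13 * I.m ≤ B) (d : ℕ) : ∀ (r : ℕ) (σ : State), r + d = I.m →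
    Copied I B r σ →
    ∃ t τ, Exec B (.loop 7 1 copyEnds) σ t τ ∧ t ≤ 11 * d + 1 ∧ Copied I B I.m τ := by
  induction d with
  | zero =>
    rintro r σ rfl h
    exact ⟨1, σ, .loop_done (by rw [h.counter, h.demands]; omega), by omega, h⟩
  | succ d ih =>
    intro r σ hrd h
    obtain ⟨t, τ, h1, h2, h3⟩ := copyEnds_spec hB (by omega) h
    obtain ⟨t', ρ, k1, k2, k3⟩ := ih (r + 1) τ (by omega) h3
    exact ⟨t + t' + 1, ρ, .loop_step (by rw [h.counter, h.demands]; omega) h1 k1, by omega, k3⟩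

theorem readInput_spec (hB : 13 * I.m ≤ B) (hB2 : 2 ≤ B) (hI : I.input.BoundedBy B) :
    ∃ t τ, Exec B readInput I.input t τ ∧ t ≤ 11 * I.m + 20 ∧ Copied I B I.m τ := by
  let σ₁ := I.input.setReg 2 I.n
  let σ₂ := σ₁.setReg 3 1
  have hn : I.n ≤ B := hI.1 0
  have x1 : Exec B (.copy 2 0) I.input 1 σ₁ := .copy I.input 2 0 (hI.1 0)
  have x2 : Exec B (.const 3 1) σ₁ 1 σ₂ := .const σ₁ 3 1 (by omega)
  have b₂ : σ₂.BoundedBy B := (hI.setReg 2 hn).setReg 3 (by omega)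
  obtain ⟨t, σ₃, x3, ht, b₃, hmem, hreg, hbase⟩ := initBases_spec (m := I.m) b₂
    (by simp [σ₂, σ₁, State.setReg, Instance.input]) 12 (by omega)
  let σ₄ := σ₃.setReg 6 2
  let σ₅ := σ₄.setReg 5 (I.input.mem 2)
  let σ₆ := σ₅.setReg 6 0
  have x4 : Exec B (.const 6 2) σ₃ 1 σ₄ := .const σ₃ 6 2 hB2
  have x5 : Exec B (.load 5 6) σ₄ 1 σ₅ := by
    have e : σ₄.mem (σ₄.reg 6) = I.input.mem 2 := by
      simp only [σ₄, State.setReg, Function.update_self, hmem]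
      rfl
    have := Exec.load (B := B) σ₄ 5 6
    rw [e] at this
    exact this (hI.2 2)
  have x6 : Exec B (.const 6 0) σ₅ 1 σ₆ := .const σ₅ 6 0 (Nat.zero_le _)
  have hcop : Copied I B 0 σ₆ := by
    have hreg' : ∀ x < 40, x ≠ 5 → x ≠ 6 → σ₆.reg x = σ₂.reg x := by
      intro x hx h5 h6
      rw [← hreg x hx]
      simp [σ₆, σ₅, σ₄, State.setReg, h5, h6]
    constructor
    · exact ((b₃.setReg 6 hB2).setReg 5 (hI.2 2)).setReg 6 (Nat.zero_le _)
    · rw [hreg' 1 (by omega) (by omega) (by omega)]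
      simp [σ₂, σ₁, State.setReg, Instance.input]
    · rw [hreg' 2 (by omega) (by omega) (by omega)]
      simp [σ₂, σ₁, State.setReg]
    · rw [hreg' 3 (by omega) (by omega) (by omega)]
      simp [σ₂, State.setReg]
    · rw [hreg' 4 (by omega) (by omega) (by omega)]
      simp [σ₂, σ₁, State.setReg, Instance.input]
    · simp [σ₆, σ₅, State.setReg]
    · simp [σ₆, State.setReg]
    · rw [hreg' 7 (by omega) (by omega) (by omega)]
      simp [σ₂, σ₁, State.setReg, Instance.input]
    · intro i hi
      rw [← hbase i hi]
      simp only [σ₆, σ₅, σ₄, State.setReg]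
      rw [Function.update_of_ne (by omega), Function.update_of_ne (by omega),
        Function.update_of_ne (by omega)]
    · intro i _
      exact congrFun hmem i
    · simp
    · simp
  obtain ⟨t', τ, x7, ht', hτ⟩ := copyLoop_spec hB I.m 0 σ₆ (by omega) hcop
  exact ⟨_, τ, .seq x1 <| .seq x2 <| .seq x3 <| .seq x4 <| .seq x5 <| .seq x6 x7, by omega, hτ⟩

theorem input_boundedBy (I : Instance) : I.input.BoundedBy I.size := by
  refine ⟨fun x => ?_, fun i => ?_⟩
  · simp only [Instance.input, Instance.size]
    split_ifs <;> omega
  · simp only [Instance.input, Instance.size]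
    split_ifs with h
    · have := I.lo_lt_hi ⟨i / 3, h⟩
      have := I.hi_le_n ⟨i / 3, h⟩
      omega
    · have := I.hi_le_n ⟨i / 3, h⟩
      omega
    · have := Finset.le_sup (f := I.w) (mem_univ (⟨i / 3, h⟩ : Fin I.m))
      omega
    · omega

end ReadInput

end MCRPC

/-- One program solves all uniform-weight instances in `O(2 ^ k * |D| ^ 4)` steps, on words of
`O(log size)` bits. The summand `1` matters only when there are no demands. -/
theorem theorem6 :
    ∃ (P : MCRPC.Prog) (c C : ℕ), ∀ I : MCRPC.Instance, I.Uniform →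
      ∃ (t : ℕ) (τ : MCRPC.State), MCRPC.Exec (I.size ^ c) P I.input t τ ∧
        t ≤ C * (2 ^ I.k * I.m ^ 4 + 1) ∧ I.IsSolution τ := by
  -- the exponent `6` suffices for addresses, which are below `13 * m`, and for the optimal value,
  -- which is at most `size ^ 2`
  refine ⟨.seq MCRPC.readInput MCRPC.HProg.main.compile, 6, 240, fun I hU => ?_⟩
  obtain ⟨c, hc⟩ := hU
  have hsize : I.n + I.m + 2 ≤ I.size := by
    unfold MCRPC.Instance.size
    omega
  have hpow : 32 * I.size ≤ I.size ^ 6 := by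
    have : 2 ^ 5 * I.size ≤ I.size ^ 5 * I.size :=
      Nat.mul_le_mul_right _ (Nat.pow_le_pow_left (by omega) 5)
    rwa [← pow_succ] at this
  have hin := MCRPC.input_boundedBy I
  obtain ⟨t, σ, h1, ht, hσ⟩ := MCRPC.readInput_spec (I := I) (B := I.size ^ 6) (by omega) (by omega)
    ⟨fun x => (hin.1 x).trans (by omega), fun i => (hin.2 i).trans (by omega)⟩
  -- the contents of the variables and arrays are read off the machine state
  let s : MCRPC.HState := ⟨fun x => σ.reg x.ctorIdx, fun j i => σ.mem (j.code * I.m + i)⟩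
  have hrep : MCRPC.Rep (I.size ^ 6) I.m s σ :=
    ⟨fun _ => rfl, fun j => hσ.base _ (by have := j.code_lt; omega), fun _ _ _ => rfl,
      hσ.bounded.1, hσ.bounded.2⟩
  have hw : 0 < I.m → s.v .weight = c := by
    intro hm
    have : s.v .weight = I.input.mem 2 := hσ.weight
    rw [this, ← hc ⟨0, hm⟩]
    simp [MCRPC.Instance.input, hm]
  have hw' : I.m * s.v .weight ≤ I.size ^ 6 := by
    have h2 : s.v .weight ≤ I.size := by
      have : s.v .weight = I.input.mem 2 := hσ.weight
      rw [this]
      exact hin.2 2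
    calc I.m * s.v .weight ≤ I.size * I.size := Nat.mul_le_mul (by omega) h2
      _ = I.size ^ 2 := (sq _).symm
      _ ≤ I.size ^ 6 := Nat.pow_le_pow_right (by omega) (by omega)
  obtain ⟨t', τ, s', h2, hrep', -, ht', R, hR, hopt, hres⟩ :=
    MCRPC.main_spec (I := I) (s := s) hσ.demands hσ.nodes hσ.one hσ.zero (fun q => hσ.lo q q.2)
      (fun q => hσ.hi q q.2) (by omega) (by omega) hw hw' σ hrep
  have homega := MCRPC.Instance.omega_eq_mul hc
  have hopt' : ∀ R' : I.Routing, I.omega R ≤ I.omega R' := fun R' => by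
    rw [homega, homega]
    exact Nat.mul_le_mul_right _ (hopt R')
  have hcl := MCRPC.Instance.cl_eq_omega hopt'
  refine ⟨t + t', τ, .seq h1 h2, ?_, R, fun p => ?_, hopt', hcl.symm, ?_⟩
  · have h4 : 1 * I.m ^ 4 ≤ 2 ^ I.k * I.m ^ 4 := Nat.mul_le_mul_right _ Nat.one_le_two_pow
    have h5 : I.m ≤ I.m ^ 4 := Nat.le_self_pow (by omega) _
    omega
  · have := hrep'.arr .out p p.2
    rw [hR p p.2, MCRPC.bits_fin] at this
    simpa [MCRPC.Arr.code] using this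
  · have : τ.reg 0 = s'.v .res := hrep'.var .res
    rw [this, hres, hcl, homega]
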